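/- Graphs are finite and loopless but may have parallel edges. A graph is subcubic if every vertex has degree at most $3$. A graph is $2$-connected if it has at least two vertices, is connected, and remains connected after the deletion of any single vertex and after the deletion of any single edge (for graphs with at least three vertices this means: connected without a cut vertex; a graph on two vertices is $2$-connected if and only if it has at least two parallel edges). A star edge-coloring of a graph $G$ is a proper edge-coloring of $G$ (distinct edges with a common end, in particular parallel edges, receive distinct colors) in which no path with four edges and no cycle with four edges is bichromatic, i.e. has edges of exactly two colors. For an integer $k$, the graph $G$ is star $k$-edge-choosable if for every assignment $L$ of a finite list $L(e)$ of colors to each edge $e$ of $G$ with $|L(e)| \ge k$ for all $e \in E(G)$, there is a star edge-coloring $\sigma$ of $G$ with $\sigma(e) \in L(e)$ for every $e \in E(G)$. **Lemma.** Every $2$-connected subcubic graph is star $7$-edge-choosable. -/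

import Mathlib

/-! Multigraphs are Mathlib's `Graph α β` (parallel edges allowed; loops are excluded in the theorem
by `Graph.Loopless`). -/

universe u v w

namespace Graph

/-- A (multi)graph is connected if it has a vertex and any two of its vertices are joined by a
walk. -/
def IsConnected {α β : Type*} (G : Graph α β) : Prop :=
  G.vertexSet.Nonempty ∧
    ∀ x ∈ G.vertexSet, ∀ y ∈ G.vertexSet, Relation.ReflTransGen G.Adj x y

/-- 2-connectedness of a (multi)graph: it has at least two vertices, it is connected, and it stays
connected after the deletion of any one vertex and after the deletion of any one edge.

On three or more vertices the condition on edges follows from the one on vertices, so that this is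
the usual "connected, at least three vertices and no cut vertex". On two vertices it says that the
two vertices are joined by at least two parallel edges; so a single edge is not 2-connected. -/
structure IsTwoConnected {α β : Type*} (G : Graph α β) : Prop where
  nontrivial : G.vertexSet.Nontrivial
  connected : G.IsConnected
  connected_deleteVert : ∀ x ∈ G.vertexSet, (G.deleteVerts {x}).IsConnected
  connected_deleteEdge : ∀ e ∈ G.edgeSet, (G.deleteEdges {e}).IsConnected

/-- Every vertex is incident with at most three edges. (In a loopless graph the degree of a vertex
is the number of edges incident with it.) -/
def IsSubcubic {α β : Type*} (G : Graph α β) : Prop :=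
  ∀ x ∈ G.vertexSet, (G.incidenceSet x).encard ≤ 3

/-- `e 0, e 1, e 2, e 3` are the consecutive edges of a path of length four
(on five distinct vertices). -/
def IsFourPath {α β : Type*} (G : Graph α β) (e : Fin 4 → G.edgeSet) : Prop :=
  ∃ x : Fin 5 → α, Function.Injective x ∧
    ∀ i : Fin 4, G.IsLink (e i : β) (x i.castSucc) (x i.succ)

/-- `e 0, e 1, e 2, e 3` are the consecutive edges of a cycle of length four
(on four distinct vertices; the addition `i + 1` is modulo 4). -/
def IsFourCycle {α β : Type*} (G : Graph α β) (e : Fin 4 → G.edgeSet) : Prop :=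
  ∃ x : Fin 4 → α, Function.Injective x ∧
    ∀ i : Fin 4, G.IsLink (e i : β) (x i) (x (i + 1))

/-- Proper edge-coloring: distinct edges with a common end (in particular, parallel edges) have
distinct colors. -/
def IsProperEdgeColoring {α β C : Type*} (G : Graph α β) (σ : G.edgeSet → C) : Prop :=
  ∀ e f : G.edgeSet, e ≠ f → ∀ x : α, G.Inc (e : β) x → G.Inc (f : β) x → σ e ≠ σ f

/-- Star edge-coloring: a proper edge-coloring in which no path and no cycle of length four is
bichromatic, that is, has edges of exactly two colors. -/
structure IsStarEdgeColoring {α β C : Type*} (G : Graph α β) (σ : G.edgeSet → C) : Prop where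
  proper : G.IsProperEdgeColoring σ
  path : ∀ e : Fin 4 → G.edgeSet, G.IsFourPath e → (Set.range (σ ∘ e)).encard ≠ 2
  cycle : ∀ e : Fin 4 → G.edgeSet, G.IsFourCycle e → (Set.range (σ ∘ e)).encard ≠ 2

/-- `G` is star `L`-edge-colorable: there is a star edge-coloring that takes the color of every edge
from the list of that edge. -/
def IsStarListEdgeColorable {α β C : Type*} (G : Graph α β) (L : G.edgeSet → Finset C) : Prop :=
  ∃ σ : G.edgeSet → C, G.IsStarEdgeColoring σ ∧ ∀ e, σ e ∈ L e

/-- `G` is star `k`-edge-choosable: it is star `L`-edge-colorable for every assignment `L` of lists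
with at least `k` colors each, for every type `C` of colors. -/
def IsStarEdgeChoosable {α : Type u} {β : Type v} (G : Graph α β) (k : ℕ) : Prop :=
  ∀ (C : Type w) (L : G.edgeSet → Finset C), (∀ e, k ≤ (L e).card) → G.IsStarListEdgeColorable L

end Graph

/-! The edges are split into a matching `M` covering all vertices of degree three and a rest of
maximum degree two. Since 2-connectedness excludes edge cuts of size one, such an `M` comes from
Tutte's theorem (`exists_matching_covering_cubic`). The rest is a union of paths and cycles, which
can be oriented and completed to the arcs `v → π v` of a permutation (`exists_perm_cover`).

The matching is colored first, by `φ`. An arc `v → π v` then discards the four colors at `π⁻¹ v`,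
`v`, `π v`, `π² v`: the middle two secure properness, and the outer two keep a matching edge from
agreeing in color with an arc at distance one. If in addition matching edges joined by an arc
differ, no bichromatic path or cycle with four edges meets `M`, and only directed cycles of arcs
remain to be star colored.

After trimming all lists to seven colors, every arc keeps at least 7 - 4 = 3. Three colors per arc
suffice on every cycle except a pentagon whose lists are all the same 3-set
(`exists_cyclic_coloring`). That exception is prevented while coloring `M`: given the other matching
colors, a pentagon through an end of a matching edge is spoiled by at most one color of that edge
(`eq_of_constant_residualList`). A matching edge thus faces at most four arc constraints and two
pentagon constraints, six in all, and a greedy choice from seven colors succeeds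
(`exists_matching_coloring`). -/

/-! ### Star colorings of cycles and permutations from lists of size three -/

/-- A greedy coloring of a ray from lists of three colors in which any three consecutive colors
are distinct. -/
theorem exists_seq_of_three_le_card {C : Type*} (R : ℕ → Finset C) (hR : ∀ k, 3 ≤ (R k).card)
    {c : C} (hc : c ∈ R 0) :
    ∃ h : ℕ → C, h 0 = c ∧ (∀ k, h k ∈ R k) ∧ (∀ k, h (k + 1) ≠ h k) ∧
      ∀ k, h (k + 2) ≠ h k := by
  classical
  have pick : ∀ k (a b : C), ∃ d ∈ R k, d ≠ a ∧ d ≠ b := by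
    intro k a b
    have : ((R k) \ {a, b}).Nonempty := by
      rw [← Finset.card_pos]
      have h1 := Finset.le_card_sdiff {a, b} (R k)
      have h2 : ({a, b} : Finset C).card ≤ 2 := Finset.card_le_two
      have := hR k
      omega
    obtain ⟨d, hd⟩ := this
    simp only [Finset.mem_sdiff, Finset.mem_insert, Finset.mem_singleton, not_or] at hd
    exact ⟨d, hd.1, hd.2⟩
  choose f hf hfa hfb using pick
  let st : ℕ → C × C := fun k => Nat.rec (c, c) (fun k p => (p.2, f (k + 1) p.1 p.2)) k
  have hs : ∀ k, st (k + 1) = ((st k).2, f (k + 1) (st k).1 (st k).2) := fun k => rfl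
  refine ⟨fun k => (st k).2, rfl, ?_, ?_, ?_⟩
  · rintro (_ | k)
    · exact hc
    · exact hf _ _ _
  · intro k
    simp only [hs]; exact hfb _ _ _
  · intro k
    have := hfa (k + 2) (st (k + 1)).1 (st (k + 1)).2
    simpa only [hs] using this

/-- Start greedily with `c` at position 0. The last position loses nothing by avoiding `c`, so three
colors remain there, and only two more need to be avoided to close the cycle. -/
theorem exists_cyclic_coloring_of_spare {C : Type*} [DecidableEq C] (n : ℕ) (hn : 1 ≤ n)
    (R : ℕ → Finset C)
    (hper : ∀ k, R (k + n) = R k) (hR : ∀ k, 3 ≤ (R k).card) (c : C) (hc : c ∈ R 0)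
    (hsp : 3 ≤ (R (n - 1) \ {c}).card) :
    ∃ g : ℕ → C, (∀ k, g (k + n) = g k) ∧ ∀ k, g k ∈ R k ∧ (2 ≤ n → g k ≠ g (k + 1)) ∧
      (4 ≤ n → ¬(g k = g (k + 2) ∧ g (k + 1) = g (k + 3))) := by
  have hmod : ∀ k, R k = R (k % n) := fun k => (Function.Periodic.map_mod_nat hper k).symm
  obtain rfl | hn2 : n = 1 ∨ 2 ≤ n := by omega
  · refine ⟨fun _ => c, fun _ => rfl, fun k => ⟨?_, by omega, by omega⟩⟩
    rw [hmod, Nat.mod_one]; exact hc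
  obtain ⟨h, h0, hm, h1, h2⟩ := exists_seq_of_three_le_card R hR hc
  -- Avoiding `h (n - 3)` handles the window starting at `n - 3`. If `h (n - 2) = c`, properness
  -- there is automatic and the window starting at `n - 2` requires `d ≠ h 1`; otherwise that window
  -- cannot alternate and properness requires `d ≠ h (n - 2)`. All other windows are safe by the
  -- greedy choice.
  obtain ⟨d, hd, hda, hdb⟩ : ∃ d ∈ R (n - 1) \ {c}, d ≠ h (n - 3) ∧
      d ≠ (if h (n - 2) = c then h 1 else h (n - 2)) := by
    obtain ⟨d, hd⟩ : ((R (n - 1) \ {c}) \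
        {h (n - 3), if h (n - 2) = c then h 1 else h (n - 2)}).Nonempty := by
      rw [← Finset.card_pos]
      have h1 := Finset.le_card_sdiff
        {h (n - 3), if h (n - 2) = c then h 1 else h (n - 2)} (R (n - 1) \ {c})
      have h2 : ({h (n - 3), if h (n - 2) = c then h 1 else h (n - 2)} : Finset C).card ≤ 2 :=
        Finset.card_le_two
      omega
    rw [Finset.mem_sdiff, Finset.mem_insert, Finset.mem_singleton, not_or] at hd
    exact ⟨d, hd.1, hd.2⟩
  simp only [Finset.mem_sdiff, Finset.mem_singleton] at hd
  let q : ℕ → C := fun j => if j = n - 1 then d else h j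
  have q1 : q (n - 1) = d := if_pos rfl
  have q2 : ∀ j, j < n - 1 → q j = h j := fun j hj => if_neg (by omega)
  have hdc : d ≠ c := hd.2
  have hdn2 : d ≠ h (n - 2) := by
    intro e
    by_cases hh : h (n - 2) = c
    · exact hdc (e.trans hh)
    · rw [if_neg hh] at hdb; exact hdb e
  have hgk : ∀ k, ∃ r, r < n ∧ k % n = r ∧
      ∀ j, (k + j) % n = (r + j) % n := fun k =>
    ⟨k % n, Nat.mod_lt _ (by omega), rfl, fun j => by simp⟩
  refine ⟨fun k => q (k % n), fun k => by simp, fun k => ?_⟩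
  obtain ⟨r, hr, hkr, hj⟩ := hgk k
  simp only [hj, hkr]
  refine ⟨?_, fun _ => ?_, fun hn4 => ?_⟩
  · rw [hmod k, hkr]
    by_cases hrn : r = n - 1
    · subst hrn; rw [q1]; exact hd.1
    · rw [q2 r (by omega)]; exact hm r
  · obtain h' | h' | h' : r + 1 < n - 1 ∨ r + 1 = n - 1 ∨ r = n - 1 := by omega
    · rw [Nat.mod_eq_of_lt (by omega), q2 _ h', q2 _ (by omega)]; exact (h1 r).symm
    · rw [Nat.mod_eq_of_lt (by omega), h', q1, q2 _ (by omega)]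
      have : r = n - 2 := by omega
      subst this; exact hdn2.symm
    · have e : (r + 1) % n = 0 := by rw [h', Nat.sub_add_cancel hn, Nat.mod_self]
      rw [e, h', q1, q2 0 (by omega), h0]; exact hdc
  · rintro ⟨e1, e2⟩
    have e0 : ∀ j, r + j = n → (r + j) % n = 0 := by intro j hj; rw [hj, Nat.mod_self]
    have e0' : ∀ j, r + j = n + 1 → (r + j) % n = 1 := by
      intro j hj; rw [hj, Nat.add_mod_left, Nat.mod_eq_of_lt (by omega)]
    have e0'' : ∀ j, r + j = n + 2 → (r + j) % n = 2 := by
      intro j hj; rw [hj, Nat.add_mod_left, Nat.mod_eq_of_lt (by omega)]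
    obtain h' | h' | h' | h' : r + 2 < n - 1 ∨ r + 3 = n ∨ r + 2 = n ∨ r + 1 = n := by omega
    · rw [Nat.mod_eq_of_lt (by omega), q2 _ h', q2 _ (by omega)] at e1
      exact h2 r e1.symm
    · rw [Nat.mod_eq_of_lt (by omega), show r + 2 = n - 1 by omega, q1, q2 _ (by omega),
        show r = n - 3 by omega] at e1
      exact hda e1.symm
    · rw [e0 2 h', q2 _ (by omega), q2 _ (by omega), h0, show r = n - 2 by omega] at e1
      rw [Nat.mod_eq_of_lt (by omega), show r + 1 = n - 1 by omega, q1, e0' 3 (by omega),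
        q2 _ (by omega)] at e2
      rw [if_pos e1] at hdb
      exact hdb e2
    · rw [e0 1 h', e0'' 3 (by omega), q2 _ (by omega), q2 _ (by omega)] at e2
      exact h2 0 e2.symm

/-- A cyclic word over three letters that is a star edge-coloring of the cycle of length `n`. -/
theorem exists_cyclic_pattern (n : ℕ) (hn : 2 ≤ n) (h5 : n ≠ 5) :
    ∃ p : ℕ → ℕ, (∀ k, p (k + n) = p k) ∧ ∀ k, p k < 3 ∧ p k ≠ p (k + 1) ∧
      (4 ≤ n → ¬(p k = p (k + 2) ∧ p (k + 1) = p (k + 3))) := by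
  obtain ⟨b, hb⟩ : ∃ b, n % 3 = b := ⟨_, rfl⟩
  have hb3 : b = 0 ∨ b = 1 ∨ b = 2 := by omega
  -- The word consists of `n % 3` blocks 0102 followed by blocks 012. These lengths fit for every `n
  -- ≥ 2` other than 2 and 5; for `n = 2` the prefix 01 serves.
  obtain ⟨q, hq⟩ : ∃ q : ℕ → ℕ, ∀ j, q j = if j < 4 * b then
    (if j % 4 = 1 then 1 else if j % 4 = 3 then 2 else 0) else (j - 4 * b) % 3 := ⟨_, fun _ => rfl⟩
  have hlt : ∀ j, q j < 3 := by
    intro j; rw [hq]; split_ifs <;> omega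
  have hne : ∀ j, q j ≠ q (j + 1) := by
    intro j; rw [hq, hq]; split_ifs <;> omega
  -- An alternating window would need such repetitions at two consecutive positions, one of which is
  -- odd.
  have heven : ∀ j, q j = q (j + 2) → j % 2 = 0 := by
    intro j; rw [hq, hq]; split_ifs <;> omega
  have hq0 : q 0 = 0 := by
    rw [hq]; split_ifs <;> omega
  have hq1 : q 1 = 1 := by
    rw [hq]; rcases hb3 with rfl | rfl | rfl <;> rfl
  have hlast : q (n - 1) = 2 ∨ n = 2 := by
    rw [hq]; split_ifs <;> omega
  have hlast' : q (n - 2) = 0 → n % 4 = 0 ∨ n ≤ 2 := by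
    rw [hq]; split_ifs <;> omega
  refine ⟨fun k => q (k % n), fun k => by simp, fun k => ?_⟩
  have hr : k % n < n := Nat.mod_lt _ (by omega)
  have hm : ∀ j, (k + j) % n = (k % n + j) % n := by simp
  simp only [hm]
  generalize k % n = r at hr
  have e0 : ∀ j, r + j = n → (r + j) % n = 0 := by intro j hj; rw [hj, Nat.mod_self]
  have e1 : ∀ j, 2 ≤ n → r + j = n + 1 → (r + j) % n = 1 := by
    intro j _ hj; rw [hj, Nat.add_mod_left, Nat.mod_eq_of_lt (by omega)]
  have e2 : ∀ j, 4 ≤ n → r + j = n + 2 → (r + j) % n = 2 := by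
    intro j _ hj; rw [hj, Nat.add_mod_left, Nat.mod_eq_of_lt (by omega)]
  refine ⟨hlt _, ?_, ?_⟩
  · by_cases h : r + 1 = n
    · rw [e0 1 h, hq0]
      obtain h' | rfl := hlast
      · rw [show r = n - 1 by omega, h']; omega
      · rw [show r = 1 by omega, hq1]; omega
    · rw [Nat.mod_eq_of_lt (by omega)]; exact hne r
  · rintro h4 ⟨h, h'⟩
    obtain g | g | g | g : r + 3 < n ∨ r + 3 = n ∨ r + 2 = n ∨ r + 1 = n := by omega
    · rw [Nat.mod_eq_of_lt (by omega)] at h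
      rw [Nat.mod_eq_of_lt (by omega), Nat.mod_eq_of_lt (by omega)] at h'
      have := heven _ h
      have := heven _ h'
      omega
    · rw [Nat.mod_eq_of_lt (by omega)] at h
      rw [Nat.mod_eq_of_lt (by omega), e0 3 g, hq0, show r + 1 = n - 2 by omega] at h'
      have := heven _ h
      have := hlast' h'
      omega
    · rw [Nat.mod_eq_of_lt (by omega), e1 3 hn (by omega), hq1, show r + 1 = n - 1 by omega] at h'
      omega
    · rw [e1 2 hn (by omega), hq1, show r = n - 1 by omega] at h
      omega

/-- Either some color of a list can be avoided in the preceding list at no cost, and after a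
rotation the greedy coloring closes up; or each list has size three and contains its successor. In
the latter case all lists coincide, and a fixed word over three letters works for every length but
5. -/
theorem exists_cyclic_coloring {C : Type*} (n : ℕ) (hn : 1 ≤ n) (R : ℕ → Finset C)
    (hper : ∀ k, R (k + n) = R k) (hR : ∀ k, 3 ≤ (R k).card)
    (h5 : n = 5 → ¬ ∀ k, (R k).card = 3 ∧ R (k + 1) = R k) :
    ∃ g : ℕ → C, (∀ k, g (k + n) = g k) ∧ ∀ k, g k ∈ R k ∧ (2 ≤ n → g k ≠ g (k + 1)) ∧
      (4 ≤ n → ¬(g k = g (k + 2) ∧ g (k + 1) = g (k + 3))) := by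
  classical
  by_cases hsp : ∃ i, ∃ c ∈ R (i + 1), 3 ≤ (R i \ {c}).card
  · obtain ⟨i, c, hc, hi⟩ := hsp
    have hper' : Function.Periodic R n := hper
    obtain ⟨g, hg, hg'⟩ := exists_cyclic_coloring_of_spare n hn (fun k => R (k + (i + 1)))
      (fun k => by rw [add_right_comm]; exact hper _) (fun k => hR _) c (by simpa using hc)
      (by rwa [show n - 1 + (i + 1) = i + n by omega, hper])
    -- Modulo `n`, shifting forward by `(n - 1) * (i + 1)` undoes the rotation by `i + 1`, without
    -- subtraction.
    have hm : (n - 1) * (i + 1) + (i + 1) = (i + 1) * n := by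
      obtain ⟨m, rfl⟩ : ∃ m, n = m + 1 := ⟨n - 1, by omega⟩
      simp only [Nat.add_sub_cancel]; ring
    refine ⟨fun k => g (k + (n - 1) * (i + 1)), fun k => ?_, fun k => ?_⟩
    · show g (k + n + _) = g (k + _)
      rw [add_right_comm]; exact hg _
    · have := hg' (k + (n - 1) * (i + 1))
      rw [add_assoc k, hm] at this
      have e : R (k + (i + 1) * n) = R k := by
        have := hper'.nat_mul (i + 1) k
        simpa using this
      rw [e] at this
      simpa only [add_right_comm k] using this
  · push Not at hsp
    have key : ∀ i, (R i).card = 3 ∧ R (i + 1) ⊆ R i := by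
      intro i
      have hs : ∀ c ∈ R (i + 1), c ∈ R i ∧ (R i).card = 3 := by
        intro c hc
        have h1 := hsp i c hc
        have h3 := hR i
        by_cases hci : c ∈ R i
        · rw [Finset.card_sdiff_of_subset (by simpa using hci), Finset.card_singleton] at h1
          exact ⟨hci, by omega⟩
        · rw [Finset.sdiff_eq_self_of_disjoint (by simpa using hci)] at h1; omega
      obtain ⟨c, hc⟩ : (R (i + 1)).Nonempty := Finset.card_pos.1 (by have := hR (i + 1); omega)
      exact ⟨(hs c hc).2, fun c hc => (hs c hc).1⟩
    have heq : ∀ i, R (i + 1) = R i := fun i =>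
      Finset.eq_of_subset_of_card_le (key i).2 (by rw [(key i).1, (key _).1])
    have hall : ∀ i, R i = R 0 := by
      intro i
      induction i with
      | zero => rfl
      | succ i ih => rw [heq, ih]
    obtain rfl | hn2 : n = 1 ∨ 2 ≤ n := by omega
    · obtain ⟨c, hc⟩ : (R 0).Nonempty := Finset.card_pos.1 (by have := hR 0; omega)
      exact ⟨fun _ => c, fun _ => rfl, fun k => ⟨by rw [hall]; exact hc, by omega, by omega⟩⟩
    obtain ⟨p, hp, hp'⟩ := exists_cyclic_pattern n hn2 (fun h => h5 h fun k => ⟨(key k).1, heq k⟩)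
    let φ : Fin 3 ≃ R 0 := (Finset.equivFinOfCardEq (key 0).1).symm
    let φ' : ℕ → C := fun k => φ (Fin.ofNat 3 k)
    have hφ : ∀ a b, a < 3 → b < 3 → φ' a = φ' b → a = b := by
      intro a b ha hb h
      have := φ.injective (Subtype.ext h)
      simpa [Fin.ext_iff, Fin.ofNat, Nat.mod_eq_of_lt ha, Nat.mod_eq_of_lt hb] using this
    refine ⟨fun k => φ' (p k), fun k => by simp only [hp], fun k => ⟨?_, fun _ h => ?_, ?_⟩⟩
    · rw [hall]; exact (φ _).2
    · exact (hp' k).2.1 (hφ _ _ (hp' k).1 (hp' _).1 h)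
    · rintro h4 ⟨h, h'⟩
      exact (hp' k).2.2 h4 ⟨hφ _ _ (hp' k).1 (hp' _).1 h, hφ _ _ (hp' _).1 (hp' _).1 h'⟩

/-- Star list coloring of the arcs `v → π v` of a permutation digraph from lists of size three. -/
theorem exists_perm_coloring {W C : Type*} [Finite W] (π : Equiv.Perm W) (R : W → Finset C)
    (hR : ∀ v, 3 ≤ (R v).card)
    (h5 : ∀ v, Function.minimalPeriod π v = 5 →
      ¬ ∀ k : ℕ, (R ((π ^ k) v)).card = 3 ∧ R (π ((π ^ k) v)) = R ((π ^ k) v)) :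
    ∃ c : W → C, (∀ v, c v ∈ R v) ∧ (∀ v, π v ≠ v → c v ≠ c (π v)) ∧
      ∀ v, π v ≠ v → π (π v) ≠ v → π (π (π v)) ≠ v →
        ¬(c v = c (π (π v)) ∧ c (π v) = c (π (π (π v)))) := by
  classical
  have hpos : ∀ v, 1 ≤ Function.minimalPeriod π v := fun v =>
    Function.minimalPeriod_pos_of_mem_periodicPts (by
      obtain ⟨n, hn, h⟩ := (isOfFinOrder_iff_pow_eq_one.1 (isOfFinOrder_of_finite π))
      exact ⟨n, hn, by
        rw [Function.IsPeriodicPt, Function.IsFixedPt, Equiv.Perm.iterate_eq_pow, h]; rfl⟩)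
  have hper : ∀ v k, (π ^ (k + Function.minimalPeriod π v)) v = (π ^ k) v := by
    intro v k
    have := Function.isPeriodicPt_minimalPeriod π v
    rw [Function.IsPeriodicPt, Function.IsFixedPt, Equiv.Perm.iterate_eq_pow] at this
    rw [pow_add, Equiv.Perm.mul_apply, this]
  have hcyc : ∀ v, ∃ g : ℕ → C, (∀ k, g (k + Function.minimalPeriod π v) = g k) ∧
      ∀ k, g k ∈ R ((π ^ k) v) ∧ (2 ≤ Function.minimalPeriod π v → g k ≠ g (k + 1)) ∧
      (4 ≤ Function.minimalPeriod π v → ¬(g k = g (k + 2) ∧ g (k + 1) = g (k + 3))) := by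
    intro v
    refine exists_cyclic_coloring _ (hpos v) (fun k => R ((π ^ k) v))
      (fun k => by simp only [hper]) (fun k => hR _) fun h h' => h5 v h fun k => ?_
    have := h' k
    rwa [pow_succ', Equiv.Perm.mul_apply] at this
  choose g hg hg' using hcyc
  let s := Equiv.Perm.SameCycle.setoid π
  -- Each cycle gets one base point, and colors are read off along the cycle from there. By `hgeq`
  -- the exponent used to reach a vertex does not matter.
  let b : W → W := fun v => (Quotient.mk s v).out
  have hb : ∀ v, ∃ k : ℕ, (π ^ k) (b v) = v := fun v =>
    (show π.SameCycle (b v) v from Quotient.mk_out (s := s) v).exists_nat_pow_eq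
  have hbπ : ∀ v, b (π v) = b v := by
    intro v
    have : Quotient.mk s (π v) = Quotient.mk s v :=
      Quotient.sound (show π.SameCycle (π v) v from (Equiv.Perm.sameCycle_apply_left).2 (.refl _ _))
    simp only [b, this]
  choose k hk using hb
  have hgeq : ∀ v i j, (π ^ i) v = (π ^ j) v → g v i = g v j := by
    intro v i j h
    rw [← Equiv.Perm.iterate_eq_pow, ← Equiv.Perm.iterate_eq_pow] at h
    have h1 : i % Function.minimalPeriod π v = j % Function.minimalPeriod π v := by
      rw [← Function.iterate_mod_minimalPeriod_eq, ← Function.iterate_mod_minimalPeriod_eq (n := j)]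
        at h
      exact Function.iterate_injOn_Iio_minimalPeriod (Nat.mod_lt _ (hpos v))
        (Nat.mod_lt _ (hpos v)) h
    rw [← Function.Periodic.map_mod_nat (hg v) i, h1, Function.Periodic.map_mod_nat (hg v) j]
  have hc1 : ∀ v j, g (b v) (k v + j) = g (b ((π ^ j) v)) (k ((π ^ j) v)) := by
    intro v j
    have hbj : b ((π ^ j) v) = b v := by
      induction j with
      | zero => rfl
      | succ j ih => rw [pow_succ', Equiv.Perm.mul_apply, hbπ, ih]
    rw [hbj]
    apply hgeq
    rw [add_comm, pow_add, Equiv.Perm.mul_apply, hk, ← hbj, hk]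
  have hdvd : ∀ v i, Function.minimalPeriod π (b v) = i → (π ^ i) v = v := by
    rintro v i rfl
    have := hper (b v) (k v)
    rwa [add_comm, pow_add, Equiv.Perm.mul_apply, hk] at this
  refine ⟨fun v => g (b v) (k v), fun v => ?_, fun v hv => ?_, fun v h1 h2 h3 => ?_⟩
  · have := (hg' (b v) (k v)).1
    rwa [hk] at this
  · have hn : 2 ≤ Function.minimalPeriod π (b v) := by
      have := hpos (b v)
      by_contra h
      exact hv (hdvd v 1 (by omega))
    have := (hg' (b v) (k v)).2.1 hn
    rwa [hc1 v 1] at this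
  · have hn : 4 ≤ Function.minimalPeriod π (b v) := by
      have := hpos (b v)
      by_contra h
      obtain h | h | h : Function.minimalPeriod π (b v) = 1 ∨ Function.minimalPeriod π (b v) = 2 ∨
        Function.minimalPeriod π (b v) = 3 := by omega
      · exact h1 (hdvd v 1 h)
      · exact h2 (hdvd v 2 h)
      · exact h3 (hdvd v 3 h)
    have := (hg' (b v) (k v)).2.2 hn
    rwa [hc1 v 1, hc1 v 2, hc1 v 3] at this

/-! ### Coloring the matching -/

/-- Greedy list coloring subject to constraints: `B k` is the set of colorings violating the
constraint `k`, which only depends on the colors on `scope k`, and each variable lies in the scope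
of fewer constraints than its list has colors. -/
theorem exists_coloring_of_constraints {Q K C : Type*} [Finite Q] [DecidableEq Q]
    (L : Q → Finset C)
    (scope : K → Finset Q) (B : K → (Q → C) → Prop)
    (hB : ∀ k f f', (∀ q ∈ scope k, f q = f' q) → B k f → B k f')
    (hne : ∀ k f, scope k = ∅ → ¬ B k f)
    (hB1 : ∀ k f, ∀ q ∈ scope k, ∀ a b, B k (Function.update f q a) →
      B k (Function.update f q b) → a = b)
    (hcount : ∀ q, ∃ T : Finset K, T.card < (L q).card ∧ ∀ k, q ∈ scope k → k ∈ T) :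
    ∃ f : Q → C, (∀ q, f q ∈ L q) ∧ ∀ k, ¬ B k f := by
  classical
  cases nonempty_fintype Q
  have hL : ∀ q, (L q).Nonempty := fun q => by
    obtain ⟨T, hT, -⟩ := hcount q
    exact Finset.card_pos.1 (by omega)
  suffices h : ∀ S : Finset Q, ∃ f : Q → C, (∀ q, f q ∈ L q) ∧ ∀ k, scope k ⊆ S → ¬ B k f by
    obtain ⟨f, hf, h⟩ := h Finset.univ
    exact ⟨f, hf, fun k => h k (Finset.subset_univ _)⟩
  intro S
  induction S using Finset.induction_on with
  | empty =>
    exact ⟨fun q => (hL q).choose, fun q => (hL q).choose_spec, fun k hk =>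
      hne k _ (Finset.subset_empty.1 hk)⟩
  | insert q S hq ih =>
    obtain ⟨f, hf, hfS⟩ := ih
    obtain ⟨T, hT, hqT⟩ := hcount q
    -- The colors forbidden at `q` by the present values elsewhere: by `hB1` each constraint
    -- contributes at most one.
    let F : Finset C := T.biUnion fun k =>
      if q ∈ scope k then {a ∈ L q | B k (Function.update f q a)} else ∅
    have hF : F.card ≤ T.card := by
      refine (Finset.card_biUnion_le_card_mul _ _ 1 fun k _ => ?_).trans (by simp)
      split_ifs with h
      · refine Finset.card_le_one.2 fun a ha b hb => ?_
        exact hB1 k f q h a b (Finset.mem_filter.1 ha).2 (Finset.mem_filter.1 hb).2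
      · simp
    obtain ⟨a, ha, haF⟩ : ∃ a ∈ L q, a ∉ F := by
      by_contra! h
      have := Finset.card_le_card (show L q ⊆ F from h)
      omega
    refine ⟨Function.update f q a, fun p => ?_, fun k hk hBk => ?_⟩
    · by_cases hp : p = q
      · subst hp; simpa using ha
      · rw [Function.update_of_ne hp]; exact hf p
    · by_cases hqk : q ∈ scope k
      · refine haF (Finset.mem_biUnion.2 ⟨k, hqT k hqk, ?_⟩)
        rw [if_pos hqk]
        exact Finset.mem_filter.2 ⟨ha, hBk⟩
      · have hsub : scope k ⊆ S := fun p hp =>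
          (Finset.mem_insert.1 (hk hp)).resolve_left fun h => hqk (h ▸ hp)
        refine hfS k hsub (hB k _ _ (fun p hp => ?_) hBk)
        exact Function.update_of_ne (by rintro rfl; exact hqk hp) _ _

/-- The colors at the arc `v → π v` that do not occur, under `φ`, at the four consecutive vertices
around it. -/
def residualList {W C : Type*} [DecidableEq C] (π : Equiv.Perm W) (L : W → Finset C) (φ : W → C)
    (v : W) : Finset C :=
  L v \ {φ (π.symm v), φ v, φ (π v), φ (π (π v))}

theorem three_le_card_residualList {W C : Type*} [DecidableEq C] (π : Equiv.Perm W)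
    (L : W → Finset C) (hL : ∀ v, (L v).card = 7) (φ : W → C) (v : W) :
    3 ≤ (residualList π L φ v).card := by
  have h1 := Finset.le_card_sdiff {φ (π.symm v), φ v, φ (π v), φ (π (π v))} (L v)
  have h2 : ({φ (π.symm v), φ v, φ (π v), φ (π (π v))} : Finset C).card ≤ 4 := Finset.card_le_four
  have := hL v
  unfold residualList
  omega

/-- Going from seven colors to three means that four were really removed. This rigidity restricts
the pentagons that can be exceptional. -/
theorem pairwise_ne_of_card_residual {C : Type*} [DecidableEq C] (L : Finset C) (a b c d : C)
    (hL : L.card = 7) (h : (L \ {a, b, c, d}).card = 3) :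
    (a ∈ L ∧ b ∈ L ∧ c ∈ L ∧ d ∈ L) ∧ a ≠ b ∧ a ≠ c ∧ a ≠ d ∧ b ≠ c ∧ b ≠ d ∧ c ≠ d := by
  have h1 := Finset.card_sdiff_add_card_inter L {a, b, c, d}
  have h4 : 4 ≤ (L ∩ {a, b, c, d}).card := by omega
  have h5 : ({a, b, c, d} : Finset C).card ≤ 4 := Finset.card_le_four
  have h6 : L ∩ {a, b, c, d} = {a, b, c, d} :=
    Finset.eq_of_subset_of_card_le Finset.inter_subset_right (by omega)
  have h7 : ({a, b, c, d} : Finset C) ⊆ L := Finset.inter_eq_right.1 h6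
  refine ⟨⟨h7 (by simp), h7 (by simp), h7 (by simp), h7 (by simp)⟩, ?_⟩
  rw [h6] at h4
  have h3 : ∀ x y z : C, ({x, y, z} : Finset C).card ≤ 3 := fun x y z => Finset.card_le_three
  refine ⟨?_, ?_, ?_, ?_, ?_, ?_⟩ <;> rintro rfl
  · have := h3 a c d; simp at h4; omega
  · have := h3 b a d
    rw [Finset.insert_eq_of_mem (by simp)] at h4; omega
  · have := h3 b c a
    rw [Finset.insert_eq_of_mem (by simp)] at h4; omega
  · have := h3 a b d
    rw [Finset.insert_eq_of_mem (a := b) (by simp)] at h4; omega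
  · have := h3 a c b
    rw [Finset.insert_eq_of_mem (a := b) (by simp)] at h4; omega
  · have := h3 a b c
    rw [Finset.insert_eq_of_mem (a := c) (by simp)] at h4; omega

/-- At most one value at `w` makes all residual lists of a directed pentagon through `w` equal. -/
theorem eq_of_constant_residualList {W C : Type*} [DecidableEq C] (π : Equiv.Perm W)
    (L : W → Finset C) (hL : ∀ v, (L v).card = 7) (w : W)
    (hw : π (π (π (π (π w)))) = w) (φ φ' : W → C)
    (hφ : ∀ v, φ v ≠ φ w → φ' v = φ v)
    (h : ∀ k : ℕ, (residualList π L φ ((π ^ k) w)).card = 3 ∧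
      residualList π L φ (π ((π ^ k) w)) = residualList π L φ ((π ^ k) w))
    (h' : ∀ k : ℕ, (residualList π L φ' ((π ^ k) w)).card = 3 ∧
      residualList π L φ' (π ((π ^ k) w)) = residualList π L φ' ((π ^ k) w)) :
    φ w = φ' w := by
  have hw' : π.symm w = π (π (π (π w))) := by rw [Equiv.symm_apply_eq, hw]
  have c0 := (h 0).1
  have c3 := (h 3).1
  have r0 := (h 0).2
  have r1 := (h 1).2
  have r0' := (h' 0).2
  have r1' := (h' 1).2
  simp only [pow_succ', pow_zero, Equiv.Perm.mul_apply, Equiv.Perm.one_apply, mul_one] at *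
  rw [r0] at r1
  rw [r0'] at r1'
  simp only [residualList, Equiv.symm_apply_apply, hw'] at *
  have d0 := pairwise_ne_of_card_residual _ _ _ _ _ (hL _) c0
  have d3 := pairwise_ne_of_card_residual _ _ _ _ _ (hL _) c3
  rw [hw] at d3
  -- Tightness of the residual lists at `w` and `π³ w` makes `φ w` differ from `φ` at the other four
  -- vertices, so passing to `φ'` leaves those values alone.
  have e1 := hφ (π w) d0.2.2.2.2.1.symm
  have e2 := hφ (π (π w)) d0.2.2.2.2.2.1.symm
  have e3 := hφ (π (π (π w))) d3.2.2.2.2.2.1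
  have e4 := hφ (π (π (π (π w)))) d0.2.1
  rw [e1, e2, e3, e4] at r1'
  by_contra hne
  -- The residual list at `π² w` omits the four vertices other than `w`, hence is the same for `φ`
  -- and `φ'`. By constancy so is the list at `w`; but the old one lacks `φ w`, while the new one
  -- would contain it.
  have m1 : φ w ∈ L w \ {φ (π (π (π (π w)))), φ' w, φ (π w), φ (π (π w))} := by
    simp only [Finset.mem_sdiff, Finset.mem_insert, Finset.mem_singleton, not_or]
    exact ⟨d0.1.2.1, d0.2.1.symm, hne, d0.2.2.2.2.1, d0.2.2.2.2.2.1⟩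
  rw [← r1', r1] at m1
  simp at m1

/-- Coloring of the matching edges: `τ` sends a vertex to its partner. Matching edges joined by an
arc get distinct colors, and no directed pentagon has constant residual lists of size three. -/
theorem exists_matching_coloring {W C : Type*} [Finite W] [DecidableEq C] (π : Equiv.Perm W)
    (τ : W → W) (hτ : Function.Involutive τ) (LF LM : W → Finset C) (hLF : ∀ v, (LF v).card = 7)
    (hLM : ∀ v, (LM v).card = 7) (hτL : ∀ v, LM (τ v) = LM v) :
    ∃ φ : W → C, (∀ v, φ (τ v) = φ v) ∧ (∀ v, φ v ∈ LM v) ∧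
      (∀ v, π v ≠ v → π v ≠ τ v → φ v ≠ φ (π v)) ∧
      ∀ v, Function.minimalPeriod π v = 5 →
        ¬ ∀ k : ℕ, (residualList π LF φ ((π ^ k) v)).card = 3 ∧
          residualList π LF φ (π ((π ^ k) v)) = residualList π LF φ ((π ^ k) v) := by
  classical
  cases nonempty_fintype W
  let sM : Setoid W :=
    { r := fun v w => w = v ∨ w = τ v
      iseqv := ⟨fun v => Or.inl rfl,
        fun {v w} h => by
          rcases h with rfl | rfl
          · exact Or.inl rfl
          · exact Or.inr (hτ v).symm,
        fun {u v w} h h' => by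
          rcases h with rfl | rfl
          · exact h'
          · rcases h' with rfl | rfl
            · exact Or.inr rfl
            · exact Or.inl (hτ u)⟩ }
  let mk : W → Quotient sM := Quotient.mk sM
  have hmk : ∀ v w, mk v = mk w ↔ w = v ∨ w = τ v := fun v w => Quotient.eq
  let sO := Equiv.Perm.SameCycle.setoid π
  let orb : W → Quotient sO := Quotient.mk sO
  have horb : ∀ v k, orb ((π ^ k : Equiv.Perm W) v) = orb v := fun v (k : ℕ) =>
    Quotient.sound (show π.SameCycle ((π ^ k) v) v from
      Equiv.Perm.sameCycle_pow_left.2 (.refl _ _))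
  let L : Quotient sM → Finset C := fun q => LM q.out
  have hL : ∀ v, L (mk v) = LM v := by
    intro v
    have : mk (mk v).out = mk v := Quotient.out_eq _
    rcases (hmk _ _).1 this with h | h
    · show LM (mk v).out = LM v
      rw [← h]
    · show LM (mk v).out = LM v
      rw [← hτL (mk v).out, ← h]
  let scope : W ⊕ Quotient sO → Finset (Quotient sM) := fun k =>
    Sum.elim (fun v => {mk v, mk (π v)}) (fun o => Finset.image mk {w | orb w = o}) k
  -- One constraint per arc, void when its ends lie in the same matching class, and one per orbit of
  -- `π`.
  let B : W ⊕ Quotient sO → (Quotient sM → C) → Prop := fun k f =>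
    Sum.elim (fun v => mk v ≠ mk (π v) ∧ f (mk v) = f (mk (π v)))
      (fun o => ∀ w, orb w = o → π (π (π (π (π w)))) = w ∧
        (residualList π LF (f ∘ mk) w).card = 3 ∧
        residualList π LF (f ∘ mk) (π w) = residualList π LF (f ∘ mk) w) k
  suffices H : ∃ f, (∀ q, f q ∈ L q) ∧ ∀ k, ¬ B k f by
    obtain ⟨f, hf, hfB⟩ := H
    refine ⟨f ∘ mk, fun v => ?_, fun v => ?_, fun v h h' e => ?_, fun v hv h => ?_⟩
    · exact congrArg f ((hmk _ _).2 (Or.inr (hτ v).symm))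
    · rw [← hL]; exact hf _
    · exact hfB (Sum.inl v) ⟨fun hm => ((hmk _ _).1 hm).elim h h', e⟩
    · refine hfB (Sum.inr (orb v)) fun w hw => ?_
      obtain ⟨k, rfl⟩ : ∃ k : ℕ, (π ^ k) v = w :=
        (show π.SameCycle v w from Quotient.exact hw.symm).exists_nat_pow_eq
      refine ⟨?_, h k⟩
      have h5 := Function.isPeriodicPt_minimalPeriod π v
      rw [hv, Function.IsPeriodicPt, Function.IsFixedPt, Equiv.Perm.iterate_eq_pow] at h5
      show (π ^ 5) ((π ^ k) v) = _
      rw [← Equiv.Perm.mul_apply, ← pow_add, add_comm, pow_add, Equiv.Perm.mul_apply, h5]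
  refine exists_coloring_of_constraints L scope B ?_ ?_ ?_ ?_
  · rintro (v | o) f f' hff' hB
    · have h1 : f (mk v) = f' (mk v) := hff' _ (by simp [scope])
      have h2 : f (mk (π v)) = f' (mk (π v)) := hff' _ (by simp [scope])
      exact ⟨hB.1, by rw [← h1, ← h2]; exact hB.2⟩
    · have hmem : ∀ w, orb w = o → (f ∘ mk) w = (f' ∘ mk) w := fun w hw =>
        hff' _ (Finset.mem_image.2 ⟨w, by simpa using hw, rfl⟩)
      have hres : ∀ w, orb w = o →
          residualList π LF (f ∘ mk) w = residualList π LF (f' ∘ mk) w := by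
        intro w hw
        have h1 : orb (π w) = o := (horb w 1).trans hw
        have h2 : orb (π (π w)) = o := (horb w 2).trans hw
        have h0 : orb (π.symm w) = o := by
          rw [← hw, ← horb (π.symm w) 1, pow_one, Equiv.apply_symm_apply]
        simp only [residualList, hmem _ h0, hmem _ hw, hmem _ h1, hmem _ h2]
      intro w hw
      have h1 : orb (π w) = o := (horb w 1).trans hw
      rw [← hres w hw, ← hres _ h1]
      exact hB w hw
  · rintro (v | o) f h
    · exact absurd h (Finset.insert_ne_empty _ _)
    · have : o.out ∈ ({w | orb w = o} : Finset W) := by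
        rw [Finset.mem_filter_univ]; exact Quotient.out_eq o
      exact absurd h (Finset.ne_empty_of_mem (Finset.mem_image_of_mem mk this))
  · rintro (v | o) f q hq a b ha hb
    · have hq' : q = mk v ∨ q = mk (π v) := by simpa [scope] using hq
      obtain ⟨hne, ha⟩ := ha
      obtain ⟨-, hb⟩ := hb
      rcases hq' with rfl | rfl
      · rw [Function.update_self, Function.update_of_ne hne.symm] at ha hb
        rw [ha, hb]
      · rw [Function.update_self, Function.update_of_ne hne] at ha hb
        rw [← ha, ← hb]
    · obtain ⟨w, hw, rfl⟩ := Finset.mem_image.1 hq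
      have hw' : orb w = o := by simpa using hw
      have := eq_of_constant_residualList π LF hLF w (ha w hw').1
        (Function.update f (mk w) a ∘ mk) (Function.update f (mk w) b ∘ mk)
        (fun v hv => by
          have : mk v ≠ mk w := fun e => hv (by simp only [Function.comp, e])
          simp only [Function.comp, Function.update_of_ne this])
        (fun k => (ha _ ((horb w k).trans hw')).2) (fun k => (hb _ ((horb w k).trans hw')).2)
      simpa using this
  · intro q
    obtain ⟨v, rfl⟩ : ∃ v, mk v = q := ⟨q.out, Quotient.out_eq q⟩
    -- The arcs leaving and entering the two ends, and the orbits of the two ends: six constraints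
    -- against seven colors.
    refine ⟨{Sum.inl v, Sum.inl (τ v), Sum.inl (π.symm v), Sum.inl (π.symm (τ v)),
      Sum.inr (orb v), Sum.inr (orb (τ v))}, ?_, ?_⟩
    · rw [hL, hLM]
      exact Nat.lt_succ_of_le Finset.card_le_six
    · rintro (w | o) hk
      · have hk' : mk v = mk w ∨ mk v = mk (π w) := by simpa [scope] using hk
        rw [hmk, hmk] at hk'
        rcases hk' with (h | h) | (h | h)
        · simp [h]
        · simp [h]
        · rw [← h, Equiv.symm_apply_apply]; simp
        · rw [← h, Equiv.symm_apply_apply]; simp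
      · obtain ⟨w, hw, hwv⟩ := Finset.mem_image.1 hk
        have hw' : orb w = o := by simpa using hw
        rcases (hmk _ _).1 hwv.symm with h | h
        · rw [← hw', h]; simp
        · rw [← hw', h]; simp

/-! ### Orienting multigraphs of maximum degree two -/

/-- A 2-regular multigraph with ends `s e`, `t e` can be oriented so that every vertex has in- and
out-degree one. -/
theorem exists_bijective_orientation {V E : Type*} [Fintype V] [Fintype E] [DecidableEq V]
    (s t : E → V)
    (hd : ∀ v, Finset.card {e | s e = v} + Finset.card {e | t e = v} = 2) :
    ∃ tail head : E → V, Function.Bijective tail ∧ Function.Bijective head ∧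
      ∀ e, (tail e = s e ∧ head e = t e) ∨ (tail e = t e ∧ head e = s e) := by
  classical
  -- Hall's condition, by counting incidences: `A` has `2 * A.card` of them, at most two at each
  -- vertex it meets. A system of distinct representatives gives the tails.
  have hall : ∀ A : Finset E, A.card ≤ (A.biUnion fun e => {s e, t e}).card := by
    intro A
    set N := A.biUnion fun e => {s e, t e} with hN
    have h1 : A.card = ∑ v ∈ N, Finset.card {e ∈ A | s e = v} :=
      Finset.card_eq_sum_card_fiberwise fun e he => Finset.mem_biUnion.2 ⟨e, he, by simp⟩
    have h2 : A.card = ∑ v ∈ N, Finset.card {e ∈ A | t e = v} :=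
      Finset.card_eq_sum_card_fiberwise fun e he => Finset.mem_biUnion.2 ⟨e, he, by simp⟩
    have h3 : ∑ v ∈ N, (Finset.card {e ∈ A | s e = v} + Finset.card {e ∈ A | t e = v}) ≤
        ∑ v ∈ N, 2 := by
      refine Finset.sum_le_sum fun v _ => (hd v) ▸ add_le_add ?_ ?_ <;>
      exact Finset.card_le_card (Finset.filter_subset_filter _ (Finset.subset_univ _))
    rw [Finset.sum_add_distrib, ← h1, ← h2, Finset.sum_const, smul_eq_mul] at h3
    omega
  obtain ⟨tail, hinj, htail⟩ :=
    (Finset.all_card_le_biUnion_card_iff_exists_injective _).1 hall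
  have hcard : Fintype.card E = Fintype.card V := by
    have h1 : Fintype.card E = ∑ v, Finset.card {e | s e = v} :=
      Finset.card_eq_sum_card_fiberwise fun e _ => Finset.mem_univ _
    have h2 : Fintype.card E = ∑ v, Finset.card {e | t e = v} :=
      Finset.card_eq_sum_card_fiberwise fun e _ => Finset.mem_univ _
    have h3 := Finset.sum_congr rfl fun v (_ : v ∈ (Finset.univ : Finset V)) => hd v
    rw [Finset.sum_add_distrib, ← h1, ← h2, Finset.sum_const, smul_eq_mul,
      Finset.card_univ] at h3
    omega
  have hbij : Function.Bijective tail := (Fintype.bijective_iff_injective_and_card _).2 ⟨hinj, hcard⟩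
  have htail' : ∀ e, tail e = s e ∨ tail e = t e := fun e => by simpa using htail e
  let head : E → V := fun e => if tail e = s e then t e else s e
  have hth : ∀ e, (tail e = s e ∧ head e = t e) ∨ (tail e = t e ∧ head e = s e) := by
    intro e
    by_cases h : tail e = s e
    · exact Or.inl ⟨h, if_pos h⟩
    · exact Or.inr ⟨(htail' e).resolve_left h, if_neg h⟩
  refine ⟨tail, head, hbij, ?_, hth⟩
  refine (Fintype.bijective_iff_injective_and_card _).2 ⟨fun e e' hee => ?_, hcard⟩
  have hsum : ∀ v, Finset.card {e | tail e = v} + Finset.card {e | head e = v} = 2 := by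
    intro v
    rw [← hd v]
    simp only [Finset.card_filter, ← Finset.sum_add_distrib]
    refine Finset.sum_congr rfl fun e _ => ?_
    rcases hth e with ⟨h, h'⟩ | ⟨h, h'⟩ <;> rw [h, h']
    exact add_comm _ _
  have h1 : Finset.card {e | tail e = head e'} = 1 := by
    obtain ⟨a, ha⟩ := hbij.2 (head e')
    refine Finset.card_eq_one.2 ⟨a, ?_⟩
    ext x
    rw [Finset.mem_filter_univ, Finset.mem_singleton, ← ha]
    exact hbij.1.eq_iff
  have h2 := hsum (head e')
  refine Finset.card_le_one.1 (show Finset.card {e | head e = head e'} ≤ 1 by omega) _ ?_ _ ?_ <;>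
    simp [hee]

/-- A multigraph of maximum degree two is covered by the arcs of a permutation of two copies of its
vertex set. -/
theorem exists_perm_cover {V F : Type*} [Fintype V] [Fintype F] [DecidableEq V] (s t : F → V)
    (hd : ∀ v, Finset.card {e | s e = v} + Finset.card {e | t e = v} ≤ 2) :
    ∃ (π : Equiv.Perm (V × Bool)) (tail : F → V × Bool), Function.Injective tail ∧
      ∀ e, (tail e = (s e, false) ∧ π (tail e) = (t e, false)) ∨
        (tail e = (t e, false) ∧ π (tail e) = (s e, false)) := by
  let d : V → ℕ := fun v => Finset.card {e | s e = v} + Finset.card {e | t e = v}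
  -- Two copies of the multigraph, with `2 - d v` new edges between the copies of `v`, form a
  -- 2-regular multigraph.
  let s' : (F × Bool) ⊕ (Σ v, Fin (2 - d v)) → V × Bool :=
    Sum.elim (fun p => (s p.1, p.2)) fun p => (p.1, false)
  let t' : (F × Bool) ⊕ (Σ v, Fin (2 - d v)) → V × Bool :=
    Sum.elim (fun p => (t p.1, p.2)) fun p => (p.1, true)
  obtain ⟨tail, head, ht, hh, hth⟩ := exists_bijective_orientation s' t' (by
    rintro ⟨v, b⟩
    have hdv : d v = ∑ e, (if s e = v then 1 else 0) + ∑ e, (if t e = v then 1 else 0) := by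
      simp only [d, Finset.card_filter]
    have hdv2 : d v ≤ 2 := hd v
    have hsig : ∀ I : ∀ x (_ : Fin (2 - d x)), Decidable (x = v),
        ∑ x, ∑ i : Fin (2 - d x), @ite ℕ (x = v) (I x i) 1 0 = 2 - d v := by
      intro I
      have : ∀ x, ∑ i : Fin (2 - d x), @ite ℕ (x = v) (I x i) 1 0 =
          if x = v then 2 - d x else 0 := by
        intro x; split_ifs with h <;> simp [h]
      rw [Finset.sum_congr rfl fun x _ => this x, Finset.sum_ite_eq' Finset.univ v]; simp
    simp only [Finset.card_filter, Fintype.sum_sum_type, Fintype.sum_prod_type, Fintype.sum_sigma,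
      s', t', Sum.elim_inl, Sum.elim_inr, Prod.mk.injEq, Fintype.sum_bool]
    cases b <;> simp only [and_true, and_false, if_false, reduceCtorEq, add_zero,
      zero_add, Finset.sum_const_zero, hsig] <;> omega)
  let π : Equiv.Perm (V × Bool) :=
    (Equiv.ofBijective tail ht).symm.trans (Equiv.ofBijective head hh)
  have hπ : ∀ e, π (tail e) = head e := by
    intro e
    show head ((Equiv.ofBijective tail ht).symm (tail e)) = _
    rw [Equiv.ofBijective_symm_apply_apply]
  refine ⟨π, fun e => tail (Sum.inl (e, false)), fun e e' h => ?_, fun e => ?_⟩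
  · simpa using ht.1 h
  · simp only [hπ]
    exact hth (Sum.inl (e, false))

/-! ### A matching covering the vertices of degree three -/

/-- The edges with exactly one end in `K`. -/
def edgeBoundary {V E : Type*} [Fintype E] [DecidableEq V] (s t : E → V) (K : Finset V) :
    Finset E := {e | ¬(s e ∈ K ↔ t e ∈ K)}

/-- The degree of a vertex in the multigraph with ends `s`, `t`. -/
def endDegree {V E : Type*} [Fintype E] [DecidableEq V] (s t : E → V) (v : V) : ℕ :=
  Finset.card {e | s e = v} + Finset.card {e | t e = v}

theorem sum_endDegree {V E : Type*} [Fintype E] [DecidableEq V] (s t : E → V)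
    (K : Finset V) :
    ∑ v ∈ K, endDegree s t v = (edgeBoundary s t K).card +
      2 * Finset.card {e | s e ∈ K ∧ t e ∈ K} := by
  have h : ∀ r : E → V, ∑ v ∈ K, Finset.card {e | r e = v} = Finset.card {e | r e ∈ K} := by
    intro r
    simp only [Finset.card_filter]
    rw [Finset.sum_comm]
    exact Finset.sum_congr rfl fun e _ => by rw [Finset.sum_ite_eq]
  simp only [endDegree, edgeBoundary, Finset.sum_add_distrib, h]
  simp only [Finset.card_filter, Finset.mul_sum, ← Finset.sum_add_distrib]
  refine Finset.sum_congr rfl fun e _ => ?_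
  by_cases h1 : s e ∈ K <;> by_cases h2 : t e ∈ K <;> simp [h1, h2]

/-- Parity: the degree sum over `K` is odd, so the boundary is odd, and it is not 1. -/
theorem three_le_card_edgeBoundary {V E : Type*} [Fintype E] [DecidableEq V] (s t : E → V)
    (hbr : ∀ K, (edgeBoundary s t K).card ≠ 1) (K : Finset V) (hK : Odd K.card)
    (hd : ∀ v ∈ K, endDegree s t v = 3) : 3 ≤ (edgeBoundary s t K).card := by
  have h := sum_endDegree s t K
  rw [Finset.sum_congr rfl hd, Finset.sum_const, smul_eq_mul] at h
  have := hbr K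
  obtain ⟨m, hm⟩ := hK
  omega

/-- The simple graph on two copies of `V` in which the first copy carries the edges `s e`–`t e`,
and the vertices of the first copy of degree other than three form a clique together with the
second copy. -/
def auxGraph {V E : Type*} [Fintype E] [DecidableEq V] (s t : E → V) : SimpleGraph (V ⊕ V) :=
  SimpleGraph.fromRel fun x y =>
    (∃ e, x = Sum.inl (s e) ∧ y = Sum.inl (t e)) ∨
      ((∀ v, x = Sum.inl v → endDegree s t v ≠ 3) ∧ ∀ v, y = Sum.inl v → endDegree s t v ≠ 3)

/-- At most one odd component meets the clique. Any other consists of cubic vertices and sends at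
least three edges to the deleted set `u`; since a deleted vertex receives at most three, there are
at most `u.ncard` such components. The excess of one is excluded by parity, because the second copy
of `V` makes the total order even. -/
theorem auxGraph_not_isTutteViolator {V E : Type*} [Fintype V] [Fintype E] [DecidableEq V]
    (s t : E → V)
    (hst : ∀ e, s e ≠ t e) (hd : ∀ v, endDegree s t v ≤ 3)
    (hbr : ∀ K, (edgeBoundary s t K).card ≠ 1) (u : Set (V ⊕ V)) :
    ¬ (auxGraph s t).IsTutteViolator u := by
  classical
  unfold SimpleGraph.IsTutteViolator
  set Γ := ((⊤ : (auxGraph s t).Subgraph).deleteVerts u).coe with hΓ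
  have hmem : ∀ x, x ∉ u → x ∈ ((⊤ : (auxGraph s t).Subgraph).deleteVerts u).verts :=
    fun x hx => ⟨trivial, hx⟩
  have hadj : ∀ x y (hx : x ∉ u) (hy : y ∉ u), (auxGraph s t).Adj x y →
      Γ.connectedComponentMk ⟨x, hmem x hx⟩ = Γ.connectedComponentMk ⟨y, hmem y hy⟩ := by
    intro x y hx hy h
    refine SimpleGraph.ConnectedComponent.eq.2 (SimpleGraph.Adj.reachable ?_)
    rw [hΓ, SimpleGraph.Subgraph.coe_adj, SimpleGraph.Subgraph.deleteVerts_adj]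
    exact ⟨trivial, hx, trivial, hy, h⟩
  let Q : V ⊕ V → Prop := fun x => ∀ v, x = Sum.inl v → endDegree s t v ≠ 3
  have hQ : ∀ x y (hx : x ∉ u) (hy : y ∉ u), Q x → Q y →
      Γ.connectedComponentMk ⟨x, hmem x hx⟩ = Γ.connectedComponentMk ⟨y, hmem y hy⟩ := by
    intro x y hx hy hQx hQy
    by_cases hxy : x = y
    · subst hxy; rfl
    · exact hadj x y hx hy ((SimpleGraph.fromRel_adj _ _ _).2 ⟨hxy, Or.inl (Or.inr ⟨hQx, hQy⟩)⟩)
  have hedge : ∀ e (h1 : Sum.inl (s e) ∉ u) (h2 : Sum.inl (t e) ∉ u),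
      Γ.connectedComponentMk ⟨_, hmem _ h1⟩ = Γ.connectedComponentMk ⟨_, hmem _ h2⟩ :=
    fun e h1 h2 => hadj _ _ h1 h2 ((SimpleGraph.fromRel_adj _ _ _).2
      ⟨fun h => hst e (Sum.inl_injective h), Or.inl (Or.inl ⟨e, rfl, rfl⟩)⟩)
  let vs : Γ.ConnectedComponent → Finset V := fun K =>
    {v | ∃ h : Sum.inl v ∉ u, Γ.connectedComponentMk ⟨_, hmem _ h⟩ = K}
  have hvs : ∀ K v, v ∈ vs K ↔ ∃ h : Sum.inl v ∉ u, Γ.connectedComponentMk ⟨_, hmem _ h⟩ = K :=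
    fun K v => Finset.mem_filter_univ v
  let 𝒪 : Finset Γ.ConnectedComponent := Γ.oddComponents.toFinset
  let special : Γ.ConnectedComponent → Prop := fun K =>
    ∃ x, ∃ h : x ∉ u, Q x ∧ Γ.connectedComponentMk ⟨x, hmem x h⟩ = K
  have hspecial : Finset.card {K ∈ 𝒪 | special K} ≤ 1 := by
    refine Finset.card_le_one.2 fun K hK K' hK' => ?_
    obtain ⟨-, x, hx, hQx, rfl⟩ := Finset.mem_filter.1 hK
    obtain ⟨-, y, hy, hQy, rfl⟩ := Finset.mem_filter.1 hK'
    exact hQ x y hx hy hQx hQy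
  let 𝒪' : Finset Γ.ConnectedComponent := {K ∈ 𝒪 | ¬ special K}
  have hdeg3 : ∀ K ∈ 𝒪', ∀ v ∈ vs K, endDegree s t v = 3 := by
    intro K hK v hv
    by_contra h
    obtain ⟨hvu, hvK⟩ := (hvs K v).1 hv
    refine (Finset.mem_filter.1 hK).2 ⟨Sum.inl v, hvu, fun w hw => ?_, hvK⟩
    rwa [← Sum.inl_injective hw]
  have hodd : ∀ K ∈ 𝒪', Odd (vs K).card := by
    intro K hK
    have h1 : Odd K.supp.ncard := by simpa [𝒪] using (Finset.mem_filter.1 hK).1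
    have h2 : Subtype.val '' K.supp = Sum.inl '' (vs K : Set V) := by
      ext x
      constructor
      · rintro ⟨⟨x, hx⟩, hxK, rfl⟩
        rcases x with v | v
        · exact ⟨v, (hvs K v).2 ⟨hx.2, hxK⟩, rfl⟩
        · exact absurd ⟨Sum.inr v, hx.2, by simp [Q], hxK⟩ (Finset.mem_filter.1 hK).2
      · rintro ⟨v, hv, rfl⟩
        obtain ⟨hvu, hvK⟩ := (hvs K v).1 hv
        exact ⟨⟨_, hmem _ hvu⟩, hvK, rfl⟩
    rwa [← Set.ncard_image_of_injective _ Subtype.val_injective, h2,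
      Set.ncard_image_of_injective _ Sum.inl_injective, Set.ncard_coe_finset] at h1
  let U : Finset V := {v | Sum.inl v ∈ u}
  have hU : ∀ v, v ∈ U ↔ Sum.inl v ∈ u := fun v => Finset.mem_filter_univ v
  have hUu : U.card ≤ u.ncard := by
    rw [← Set.ncard_coe_finset, ← Set.ncard_image_of_injective _ Sum.inl_injective]
    refine Set.ncard_le_ncard ?_ (Set.toFinite _)
    rintro _ ⟨v, hv, rfl⟩
    exact (hU v).1 hv
  have hbd : ∀ K e, e ∈ edgeBoundary s t (vs K) →
      (s e ∈ vs K ∧ t e ∈ U) ∨ (t e ∈ vs K ∧ s e ∈ U) := by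
    intro K e he
    rw [edgeBoundary, Finset.mem_filter_univ] at he
    by_cases h1 : s e ∈ vs K
    · refine Or.inl ⟨h1, (hU _).2 ?_⟩
      by_contra h2
      obtain ⟨h3, h4⟩ := (hvs _ _).1 h1
      exact he (iff_of_true h1 ((hvs _ _).2 ⟨h2, (hedge e h3 h2).symm.trans h4⟩))
    · have h1' : t e ∈ vs K := by
        by_contra h; exact he (iff_of_false h1 h)
      refine Or.inr ⟨h1', (hU _).2 ?_⟩
      by_contra h2
      obtain ⟨h3, h4⟩ := (hvs _ _).1 h1'
      exact h1 ((hvs _ _).2 ⟨h2, (hedge e h2 h3).trans h4⟩)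
  have hdisj : ∀ K ∈ 𝒪', ∀ K' ∈ 𝒪', K ≠ K' →
      Disjoint (edgeBoundary s t (vs K)) (edgeBoundary s t (vs K')) := by
    intro K _ K' _ hne
    have hvU : ∀ K v, v ∈ vs K → v ∉ U := fun K v hv hvU =>
      ((hvs K v).1 hv).1 ((hU v).1 hvU)
    have hvv : ∀ v, v ∈ vs K → v ∉ vs K' := by
      intro v hv hv'
      obtain ⟨_, h⟩ := (hvs _ _).1 hv
      obtain ⟨_, h'⟩ := (hvs _ _).1 hv'
      exact hne (h.symm.trans h')
    refine Finset.disjoint_left.2 fun e he he' => ?_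
    rcases hbd K e he with ⟨h1, h2⟩ | ⟨h1, h2⟩ <;> rcases hbd K' e he' with ⟨h3, h4⟩ | ⟨h3, h4⟩
    · exact hvv _ h1 h3
    · exact hvU _ _ h1 h4
    · exact hvU _ _ h1 h4
    · exact hvv _ h1 h3
  have hcount : 3 * 𝒪'.card ≤ 3 * U.card := by
    calc 3 * 𝒪'.card ≤ ∑ K ∈ 𝒪', (edgeBoundary s t (vs K)).card := by
          rw [mul_comm, ← smul_eq_mul]
          exact Finset.card_nsmul_le_sum _ _ _ fun K hK =>
            three_le_card_edgeBoundary s t hbr _ (hodd K hK) (hdeg3 K hK)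
      _ = (𝒪'.biUnion fun K => edgeBoundary s t (vs K)).card :=
          (Finset.card_biUnion hdisj).symm
      _ ≤ (edgeBoundary s t U).card := by
          refine Finset.card_le_card fun e he => ?_
          obtain ⟨K, _, he⟩ := Finset.mem_biUnion.1 he
          rw [edgeBoundary, Finset.mem_filter_univ]
          rcases hbd K e he with ⟨h1, h2⟩ | ⟨h1, h2⟩
          · exact fun h => ((hvs _ _).1 h1).1 ((hU _).1 (h.2 h2))
          · exact fun h => ((hvs _ _).1 h1).1 ((hU _).1 (h.1 h2))
      _ ≤ ∑ v ∈ U, endDegree s t v := by rw [sum_endDegree]; omega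
      _ ≤ ∑ v ∈ U, 3 := Finset.sum_le_sum fun v _ => hd v
      _ = 3 * U.card := by rw [Finset.sum_const, smul_eq_mul, mul_comm]
  have hsplit : 𝒪.card = Finset.card {K ∈ 𝒪 | special K} + 𝒪'.card :=
    (Finset.card_filter_add_card_filter_not _).symm
  have hO : Γ.oddComponents.ncard = 𝒪.card := Set.ncard_eq_toFinset_card' _
  have hpar := SimpleGraph.odd_ncard_oddComponents (G := Γ)
  have hcardV : Nat.card ((⊤ : (auxGraph s t).Subgraph).deleteVerts u).verts + u.ncard =
      2 * Fintype.card V := by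
    rw [SimpleGraph.Subgraph.deleteVerts_verts, SimpleGraph.Subgraph.verts_top,
      Nat.card_coe_set_eq, ← Set.compl_eq_univ_sdiff, add_comm, Set.ncard_add_ncard_compl,
      Nat.card_eq_fintype_card, Fintype.card_sum]
    omega
  rw [hO] at hpar ⊢
  rw [Nat.odd_iff, Nat.odd_iff] at hpar
  omega

/-- A bridgeless subcubic multigraph has a matching that covers all vertices of degree three. -/
theorem exists_matching_covering_cubic {V E : Type*} [Fintype V] [Fintype E] [DecidableEq V]
    (s t : E → V)
    (hst : ∀ e, s e ≠ t e) (hd : ∀ v, endDegree s t v ≤ 3)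
    (hbr : ∀ K, (edgeBoundary s t K).card ≠ 1) :
    ∃ M : Set E, (∀ e ∈ M, ∀ f ∈ M, ∀ v, (s e = v ∨ t e = v) → (s f = v ∨ t f = v) → e = f) ∧
      ∀ v, endDegree s t v = 3 → ∃ e ∈ M, s e = v ∨ t e = v := by
  obtain ⟨P, hP⟩ := SimpleGraph.tutte.2 (auxGraph_not_isTutteViolator s t hst hd hbr)
  rw [SimpleGraph.Subgraph.isPerfectMatching_iff] at hP
  let z : E → Sym2 V := fun e => s(s e, t e)
  -- One edge is selected from each class of parallel edges, as the simple graph does not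
  -- distinguish them.
  let rep : E → E := fun e => (Quotient.mk (Setoid.ker z) e).out
  have hrep : ∀ e, z (rep e) = z e := fun e => Quotient.mk_out (s := Setoid.ker z) e
  have hrep' : ∀ e f, z e = z f → rep e = rep f := fun e f h => by
    have : Quotient.mk (Setoid.ker z) e = Quotient.mk (Setoid.ker z) f := Quotient.sound h
    simp only [rep, this]
  refine ⟨{e | P.Adj (Sum.inl (s e)) (Sum.inl (t e)) ∧ rep e = e}, ?_, ?_⟩
  · rintro e ⟨he, he'⟩ f ⟨hf, hf'⟩ v hev hfv
    have key : ∀ e, P.Adj (Sum.inl (s e)) (Sum.inl (t e)) → (s e = v ∨ t e = v) →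
        ∃ w, P.Adj (Sum.inl v) (Sum.inl w) ∧ z e = s(v, w) := by
      rintro e he (rfl | rfl)
      · exact ⟨_, he, rfl⟩
      · exact ⟨_, he.symm, Sym2.eq_swap⟩
    obtain ⟨w, hw, hzw⟩ := key e he hev
    obtain ⟨w', hw', hzw'⟩ := key f hf hfv
    have : w = w' := Sum.inl_injective ((hP (Sum.inl v)).unique hw hw')
    rw [← he', ← hf']
    exact hrep' e f (by rw [hzw, hzw', this])
  · intro v hv
    obtain ⟨x, hx, -⟩ := hP (Sum.inl v)
    have hadj := P.adj_sub hx
    obtain ⟨-, h⟩ := (SimpleGraph.fromRel_adj _ _ _).1 hadj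
    -- A cubic vertex is outside the clique, so its partner is reached along an edge of the
    -- multigraph.
    obtain ⟨w, rfl, e, he⟩ : ∃ w, x = Sum.inl w ∧ ∃ e, z e = s(v, w) := by
      rcases h with (⟨e, h1, h2⟩ | ⟨h, -⟩) | (⟨e, h1, h2⟩ | ⟨-, h⟩)
      · exact ⟨t e, h2, e, by rw [Sum.inl_injective h1]⟩
      · exact absurd hv (h v rfl)
      · exact ⟨s e, h1, e, by rw [Sum.inl_injective h2]; exact Sym2.eq_swap⟩
      · exact absurd hv (h v rfl)
    have hr : s(s (rep e), t (rep e)) = s(v, w) := (hrep e).trans he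
    refine ⟨rep e, ⟨?_, hrep' _ _ (hrep e)⟩, ?_⟩
    · rcases Sym2.eq_iff.1 hr with ⟨h1, h2⟩ | ⟨h1, h2⟩
      · rw [h1, h2]; exact hx
      · rw [h1, h2]; exact hx.symm
    · rcases Sym2.eq_iff.1 hr with ⟨h1, h2⟩ | ⟨h1, h2⟩
      · exact Or.inl h1
      · exact Or.inr h2

/-! ### Assembling the coloring -/

/-- The edge `e` joins `x` and `y`, in the multigraph with ends `s`, `t`. -/
def Joins {V E : Type*} (s t : E → V) (e : E) (x y : V) : Prop :=
  (s e = x ∧ t e = y) ∨ (t e = x ∧ s e = y)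

theorem Joins.symm {V E : Type*} {s t : E → V} {e : E} {x y : V} (h : Joins s t e x y) :
    Joins s t e y x := by
  rcases h with ⟨h, h'⟩ | ⟨h, h'⟩
  · exact Or.inr ⟨h', h⟩
  · exact Or.inl ⟨h', h⟩

theorem Joins.left {V E : Type*} {s t : E → V} {e : E} {x y : V} (h : Joins s t e x y) :
    s e = x ∨ t e = x := h.imp And.left And.left

theorem Joins.right {V E : Type*} {s t : E → V} {e : E} {x y : V} (h : Joins s t e x y) :
    s e = y ∨ t e = y := h.symm.left

theorem Joins.eq_right {V E : Type*} {s t : E → V} {e : E} {x y z : V} (h : Joins s t e x y)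
    (h' : Joins s t e x z) : y = z := by
  rcases h with ⟨h1, h2⟩ | ⟨h1, h2⟩ <;> rcases h' with ⟨h3, h4⟩ | ⟨h3, h4⟩ <;> simp_all

theorem Joins.eq_or_eq {V E : Type*} {s t : E → V} {e : E} {x y v : V} (h : Joins s t e x y)
    (h' : s e = v ∨ t e = v) : v = x ∨ v = y := by
  rcases h with ⟨rfl, rfl⟩ | ⟨rfl, rfl⟩ <;> rcases h' with h' | h' <;> simp [h']

theorem exists_joins {V E : Type*} (s t : E → V) (e : E) (v : V) (h : s e = v ∨ t e = v) :
    ∃ w, Joins s t e v w := by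
  rcases h with h | h
  · exact ⟨_, Or.inl ⟨h, rfl⟩⟩
  · exact ⟨_, Or.inr ⟨h, rfl⟩⟩

/-- The partner of a vertex under a matching `M`, or the vertex itself if it is not covered. -/
theorem exists_partner {V E : Type*} (s t : E → V) (M : Set E)
    (hM : ∀ e ∈ M, ∀ f ∈ M, ∀ v, (s e = v ∨ t e = v) → (s f = v ∨ t f = v) → e = f) :
    ∃ mate : V → V, Function.Involutive mate ∧ (∀ e ∈ M, ∀ v w, Joins s t e v w → mate v = w) ∧
      ∀ v, mate v = v ∨ ∃ e ∈ M, Joins s t e v (mate v) := by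
  classical
  let mate : V → V := fun v => if h : ∃ w, ∃ e ∈ M, Joins s t e v w then h.choose else v
  have h1 : ∀ v, mate v = v ∨ ∃ e ∈ M, Joins s t e v (mate v) := by
    intro v
    by_cases h : ∃ w, ∃ e ∈ M, Joins s t e v w
    · right
      have : mate v = h.choose := dif_pos h
      rw [this]; exact h.choose_spec
    · exact Or.inl (dif_neg h)
  have h2 : ∀ e ∈ M, ∀ v w, Joins s t e v w → mate v = w := by
    intro e he v w hj
    have h : ∃ w, ∃ e ∈ M, Joins s t e v w := ⟨w, e, he, hj⟩
    obtain ⟨f, hf, hj'⟩ := h.choose_spec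
    have : mate v = h.choose := dif_pos h
    rw [this]
    obtain rfl := hM e he f hf v hj.left hj'.left
    exact hj'.eq_right hj
  refine ⟨mate, fun v => ?_, h2, h1⟩
  rcases h1 v with h | ⟨e, he, hj⟩
  · rw [h, h]
  · exact h2 e he _ _ hj.symm

theorem degree_off_matching_le_two {V E : Type*} [Fintype V] [Fintype E] [DecidableEq V]
    (s t : E → V) (hd : ∀ v, endDegree s t v ≤ 3) (M : Set E) [DecidablePred (· ∈ M)]
    (hM : ∀ v, endDegree s t v = 3 → ∃ e ∈ M, s e = v ∨ t e = v) (v : V) :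
    Finset.card {e : {e // e ∉ M} | s e = v} + Finset.card {e : {e // e ∉ M} | t e = v} ≤ 2 := by
  have hcard : ∀ r : E → V, Finset.card {e : {e // e ∉ M} | r e = v} =
      Finset.card {e | r e = v ∧ e ∉ M} := by
    intro r
    rw [← Finset.card_map (Function.Embedding.subtype _)]
    congr 1
    ext e
    simp [and_comm]
  have hsub : ∀ r : E → V, (Finset.filter (fun e => r e = v ∧ e ∉ M) Finset.univ) ⊆
      Finset.filter (fun e => r e = v) Finset.univ := fun r e he => by
    simp only [Finset.mem_filter_univ] at he ⊢; exact he.1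
  rw [hcard, hcard]
  have h1 := Finset.card_le_card (hsub s)
  have h2 := Finset.card_le_card (hsub t)
  have h3 := hd v
  by_cases h : endDegree s t v = 3
  · obtain ⟨e, he, hv⟩ := hM v h
    have hlt : ∀ r : E → V, r e = v → Finset.card {e | r e = v ∧ e ∉ M} <
        Finset.card {e | r e = v} := fun r hr =>
      Finset.card_lt_card ((Finset.ssubset_iff_of_subset (hsub r)).2 ⟨e, by simp [hr], by simp [he]⟩)
    unfold endDegree at h
    rcases hv with hv | hv
    · have := hlt s hv; omega
    · have := hlt t hv; omega
  · unfold endDegree at h h3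
    omega

/-- The colorings `φ` of the matching and `c` of the arcs are combined. As `x₀ ≠ x₄` is not assumed,
paths and cycles with four edges are treated at once. -/
theorem exists_star_coloring {V E C : Type*} [Fintype V] [Fintype E] [DecidableEq V]
    (s t : E → V) (hst : ∀ e, s e ≠ t e) (hd : ∀ v, endDegree s t v ≤ 3)
    (hbr : ∀ K, (edgeBoundary s t K).card ≠ 1) (L : E → Finset C) (hL : ∀ e, (L e).card = 7) :
    ∃ σ : E → C, (∀ e, σ e ∈ L e) ∧
      (∀ e f, e ≠ f → ∀ v, (s e = v ∨ t e = v) → (s f = v ∨ t f = v) → σ e ≠ σ f) ∧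
      ∀ (e : Fin 4 → E) (x₀ x₁ x₂ x₃ x₄ : V), Joins s t (e 0) x₀ x₁ → Joins s t (e 1) x₁ x₂ →
        Joins s t (e 2) x₂ x₃ → Joins s t (e 3) x₃ x₄ →
        x₀ ≠ x₁ → x₀ ≠ x₂ → x₀ ≠ x₃ → x₁ ≠ x₂ → x₁ ≠ x₃ → x₁ ≠ x₄ → x₂ ≠ x₃ → x₂ ≠ x₄ →
        x₃ ≠ x₄ → ¬ (σ (e 0) = σ (e 2) ∧ σ (e 1) = σ (e 3)) := by
  classical
  rcases isEmpty_or_nonempty E with hE | ⟨⟨e₀⟩⟩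
  · exact ⟨fun e => (hE.false e).elim, fun e => (hE.false e).elim, fun e => (hE.false e).elim,
      fun e => (hE.false (e 0)).elim⟩
  obtain ⟨M, hM, hMcov⟩ := exists_matching_covering_cubic s t hst hd hbr
  obtain ⟨mate, hinv, hmate, hmate'⟩ := exists_partner s t M hM
  obtain ⟨π, tail, htinj, htail⟩ := exists_perm_cover (fun e : {e // e ∉ M} => s e)
    (fun e => t e) (degree_off_matching_le_two s t hd M hMcov)
  -- The default `L e₀` serves uncovered vertices, where only its size matters; likewise for `LF` at
  -- arcs that are no edges.
  let LM : V × Bool → Finset C := fun p =>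
    if h : ∃ e ∈ M, s e = p.1 ∨ t e = p.1 then L h.choose else L e₀
  have hLM : ∀ e ∈ M, ∀ v b, (s e = v ∨ t e = v) → LM (v, b) = L e := by
    intro e he v b hv
    have h : ∃ e ∈ M, s e = v ∨ t e = v := ⟨e, he, hv⟩
    have h' : LM (v, b) = L h.choose := dif_pos h
    rw [h', hM _ h.choose_spec.1 e he v h.choose_spec.2 hv]
  have hLM7 : ∀ p, (LM p).card = 7 := by
    intro p
    simp only [LM]; split_ifs <;> exact hL _
  let LF : V × Bool → Finset C := fun p => if h : ∃ f, tail f = p then L h.choose else L e₀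
  have hLF : ∀ f, LF (tail f) = L f := by
    intro f
    have h : ∃ f', tail f' = tail f := ⟨f, rfl⟩
    have h' : LF (tail f) = L h.choose := dif_pos h
    rw [h', htinj h.choose_spec]
  have hLF7 : ∀ p, (LF p).card = 7 := by
    intro p
    simp only [LF]; split_ifs <;> exact hL _
  let τ : V × Bool → V × Bool := fun p => (mate p.1, p.2)
  obtain ⟨φ, hφτ, hφL, hφπ, hφ5⟩ := exists_matching_coloring π τ
    (fun p => Prod.ext (hinv p.1) rfl) LF LM hLF7 hLM7 (by
      rintro ⟨v, b⟩
      rcases hmate' v with h | ⟨e, he, hj⟩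
      · simp only [τ, h]
      · exact (hLM e he _ b hj.right).trans (hLM e he _ b hj.left).symm)
  obtain ⟨c, hcR, hcπ, hcstar⟩ := exists_perm_coloring π (residualList π LF φ)
    (three_le_card_residualList π LF hLF7 φ) hφ5
  have hc : ∀ w, c w ∈ LF w ∧ c w ≠ φ (π.symm w) ∧ c w ≠ φ w ∧ c w ≠ φ (π w) ∧
      c w ≠ φ (π (π w)) := by
    intro w
    simpa [residualList, not_or] using hcR w
  let σ : E → C := fun e => if h : e ∈ M then φ (s e, false) else c (tail ⟨e, h⟩)
  have hσM : ∀ e ∈ M, ∀ v, (s e = v ∨ t e = v) → σ e = φ (v, false) := by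
    intro e he v hv
    have h : σ e = φ (s e, false) := dif_pos he
    rcases hv with rfl | rfl
    · exact h
    · have := hφτ (s e, false)
      simp only [τ, hmate e he _ _ (Or.inl ⟨rfl, rfl⟩)] at this
      rw [h, this]
  have hσF : ∀ e, e ∉ M → ∃ w, σ e = c w ∧ (∀ f, f ∉ M → f ≠ e → ∀ h, tail ⟨f, h⟩ ≠ w) ∧
      (∀ h, tail ⟨e, h⟩ = w) ∧
      ∀ x y, Joins s t e x y → (w = (x, false) ∧ π w = (y, false)) ∨
        (w = (y, false) ∧ π w = (x, false)) := by
    intro e he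
    refine ⟨tail ⟨e, he⟩, dif_neg he, fun f hf hne h h' => ?_, fun _ => rfl, fun x y hj => ?_⟩
    · exact hne (congrArg Subtype.val (htinj h'))
    · rcases hj with ⟨rfl, rfl⟩ | ⟨rfl, rfl⟩
      · exact htail ⟨e, he⟩
      · exact (htail ⟨e, he⟩).symm
  have : Nonempty (V × Bool) := ⟨(s e₀, false)⟩
  choose! w hσw hwne hwt hwj using hσF
  have hw_inj : ∀ e f, e ∉ M → f ∉ M → e ≠ f → w e ≠ w f := by
    intro e f he hf hne h
    exact hwne f hf e he hne he ((hwt e he he).trans h)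
  -- Adjacent edges off `M` are oriented in the same sense along the walk: distinct arcs share
  -- neither a tail nor a head.
  have hcons : ∀ e f, e ∉ M → f ∉ M → e ≠ f → ∀ x y z, Joins s t e x y → Joins s t f y z →
      (w e = (x, false) ∧ w f = (y, false) ∧ π (w e) = w f ∧ π (w f) = (z, false)) ∨
      (w e = (y, false) ∧ w f = (z, false) ∧ π (w f) = w e ∧ π (w e) = (x, false)) := by
    intro e f he hf hne x y z hj hj'
    rcases hwj e he _ _ hj with ⟨h1, h2⟩ | ⟨h1, h2⟩ <;>
      rcases hwj f hf _ _ hj' with ⟨h3, h4⟩ | ⟨h3, h4⟩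
    · exact Or.inl ⟨h1, h3, h2.trans h3.symm, h4⟩
    · exact absurd (π.injective (h2.trans h4.symm)) (hw_inj e f he hf hne)
    · exact absurd (h1.trans h3.symm) (hw_inj e f he hf hne)
    · exact Or.inr ⟨h1, h3, h4.trans h1.symm, h2⟩
  have hproper : ∀ e f, e ≠ f → ∀ v, (s e = v ∨ t e = v) → (s f = v ∨ t f = v) → σ e ≠ σ f := by
    have hMF : ∀ e f, e ∈ M → f ∉ M → ∀ v, (s e = v ∨ t e = v) → (s f = v ∨ t f = v) →
        σ e ≠ σ f := by
      intro e f he hf v hev hfv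
      obtain ⟨y, hj⟩ := exists_joins s t f v hfv
      rw [hσM e he v hev, hσw f hf]
      rcases hwj f hf _ _ hj with ⟨h1, -⟩ | ⟨-, h2⟩
      · rw [← h1]; exact (hc _).2.2.1.symm
      · rw [← h2]; exact (hc _).2.2.2.1.symm
    intro e f hne v hev hfv
    by_cases he : e ∈ M <;> by_cases hf : f ∈ M
    · exact absurd (hM e he f hf v hev hfv) hne
    · exact hMF e f he hf v hev hfv
    · exact (hMF f e hf he v hfv hev).symm
    · obtain ⟨x, hx⟩ := exists_joins s t e v hev
      obtain ⟨y, hy⟩ := exists_joins s t f v hfv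
      rw [hσw e he, hσw f hf]
      rcases hcons e f he hf hne _ _ _ hx.symm hy with ⟨-, -, h, -⟩ | ⟨-, -, h, -⟩
      · rw [← h]
        exact hcπ _ fun h' => hw_inj e f he hf hne (h'.symm.trans h)
      · rw [← h]
        exact (hcπ _ fun h' => hw_inj e f he hf hne (h.symm.trans h')).symm
  -- If `e₁ ∈ M` then `e₂` is an arc. If `e₃ ∈ M`, this arc joins two matching edges, so their
  -- colors differ. If not, `e₃` avoided the color of `e₁` as that of its outer predecessor or
  -- successor, depending on the orientation.
  have hdist : ∀ e₁ e₂ e₃ a b c' d, Joins s t e₁ a b → Joins s t e₂ b c' → Joins s t e₃ c' d →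
      a ≠ b → a ≠ c' → b ≠ c' → b ≠ d → c' ≠ d → σ e₁ = σ e₃ → e₁ ∉ M := by
    intro e₁ e₂ e₃ a b c' d h₁ h₂ h₃ hab hac hbc hbd hcd hσ hm
    have h12 : e₁ ≠ e₂ := by
      rintro rfl
      exact hac (h₁.symm.eq_right h₂)
    have h23 : e₂ ≠ e₃ := by
      rintro rfl
      exact hbd (h₂.symm.eq_right h₃)
    have hm2 : e₂ ∉ M := fun hm2 => h12 (hM _ hm _ hm2 b h₁.right h₂.left)
    rw [hσM _ hm b h₁.right] at hσ
    by_cases hm3 : e₃ ∈ M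
    · rw [hσM _ hm3 c' h₃.left] at hσ
      have hmb : mate b = a := hmate _ hm _ _ h₁.symm
      have hmc : mate c' = d := hmate _ hm3 _ _ h₃
      rcases hwj e₂ hm2 _ _ h₂ with ⟨h1, h2⟩ | ⟨h1, h2⟩
      · rw [h1] at h2
        refine hφπ (b, false) ?_ ?_ (hσ.trans (congrArg φ h2.symm))
        · rw [h2]; simpa using hbc.symm
        · rw [h2]; simpa [τ, hmb] using hac.symm
      · rw [h1] at h2
        refine hφπ (c', false) ?_ ?_ (hσ.symm.trans (congrArg φ h2.symm))
        · rw [h2]; simpa using hbc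
        · rw [h2]; simpa [τ, hmc] using hbd
    · rw [hσw e₃ hm3] at hσ
      rcases hcons e₂ e₃ hm2 hm3 h23 _ _ _ h₂ h₃ with ⟨h1, -, h3, -⟩ | ⟨-, -, h3, h4⟩
      · refine (hc (w e₃)).2.1 ?_
        rw [← hσ, ← h3, Equiv.symm_apply_apply, h1]
      · refine (hc (w e₃)).2.2.2.2 ?_
        rw [← hσ, h3, h4]
  refine ⟨σ, fun e => ?_, hproper, ?_⟩
  · by_cases he : e ∈ M
    · rw [hσM e he (s e) (Or.inl rfl), ← hLM e he (s e) false (Or.inl rfl)]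
      exact hφL _
    · rw [hσw e he]
      have := (hc (w e)).1
      rwa [← hwt e he he, hLF, hwt e he he] at this
  · rintro e x₀ x₁ x₂ x₃ x₄ j₀ j₁ j₂ j₃ h01 h02 h03 h12 h13 h14 h23 h24 h34 ⟨c02, c13⟩
    have m0 := hdist _ _ _ _ _ _ _ j₀ j₁ j₂ h01 h02 h12 h13 h23 c02
    have m1 := hdist _ _ _ _ _ _ _ j₁ j₂ j₃ h12 h13 h23 h24 h34 c13
    -- Reading the walk backwards puts the last two edges off `M` too. The eight orientation
    -- patterns below then reduce to the two consistent ones.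
    have m2 := hdist _ _ _ _ _ _ _ j₂.symm j₁.symm j₀.symm h23.symm h13.symm h12.symm h02.symm
      h01.symm c02.symm
    have m3 := hdist _ _ _ _ _ _ _ j₃.symm j₂.symm j₁.symm h34.symm h24.symm h23.symm h13.symm
      h12.symm c13.symm
    have n01 : e 0 ≠ e 1 := fun h => h02 (j₀.symm.eq_right (h ▸ j₁))
    have n12 : e 1 ≠ e 2 := fun h => h13 (j₁.symm.eq_right (h ▸ j₂))
    have n23 : e 2 ≠ e 3 := fun h => h24 (j₂.symm.eq_right (h ▸ j₃))
    rw [hσw _ m0, hσw _ m2] at c02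
    rw [hσw _ m1, hσw _ m3] at c13
    rcases hcons _ _ m0 m1 n01 _ _ _ j₀ j₁ with ⟨a1, a2, a3, a4⟩ | ⟨a1, a2, a3, a4⟩ <;>
    rcases hcons _ _ m1 m2 n12 _ _ _ j₁ j₂ with ⟨b1, b2, b3, b4⟩ | ⟨b1, b2, b3, b4⟩ <;>
    rcases hcons _ _ m2 m3 n23 _ _ _ j₂ j₃ with ⟨d1, d2, d3, d4⟩ | ⟨d1, d2, d3, d4⟩
    · refine hcstar (w (e 0)) ?_ ?_ ?_ ⟨?_, ?_⟩
      · rw [a3, a1, a2]; simpa using h01.symm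
      · rw [a3, b3, a1, b2]; simpa using h02.symm
      · rw [a3, b3, d3, a1, d2]; simpa using h03.symm
      · rw [a3, b3]; exact c02
      · rw [a3, b3, d3]; exact c13
    · exact h23 (by simpa using b2.symm.trans d1)
    · exact h12 (by simpa using a2.symm.trans b1)
    · exact h12 (by simpa using a2.symm.trans b1)
    · exact h12 (by simpa using b1.symm.trans a2)
    · exact h12 (by simpa using b1.symm.trans a2)
    · exact h23 (by simpa using d1.symm.trans b2)
    · refine hcstar (w (e 3)) ?_ ?_ ?_ ⟨?_, ?_⟩
      · rw [d3, d1, d2]; simpa using h34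
      · rw [d3, b3, b1, d2]; simpa using h24
      · rw [d3, b3, a3, a1, d2]; simpa using h14
      · rw [d3, b3]; exact c13.symm
      · rw [d3, b3, a3]; exact c02.symm

/-! ### Transfer to `Graph` -/

theorem Graph.isLink_iff_joins {α β : Type*} (G : Graph α β) (s t : G.edgeSet → G.vertexSet)
    (hst : ∀ e : G.edgeSet, G.IsLink (e : β) (s e) (t e)) (e : G.edgeSet) (x y : G.vertexSet) :
    G.IsLink (e : β) x y ↔ Joins s t e x y := by
  rw [(hst e).isLink_iff]
  simp only [Joins, Subtype.ext_iff]
  constructor <;> rintro (⟨h1, h2⟩ | ⟨h1, h2⟩)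
  exacts [Or.inl ⟨h1, h2⟩, Or.inr ⟨h2, h1⟩, Or.inl ⟨h1, h2⟩, Or.inr ⟨h2, h1⟩]

/-- A set of vertices of a 2-connected graph is not separated by a single edge. -/
theorem Graph.IsTwoConnected.card_edgeBoundary_ne_one {α β : Type*} [DecidableEq α] {G : Graph α β}
    [Fintype G.edgeSet] (h : G.IsTwoConnected) (s t : G.edgeSet → G.vertexSet)
    (hst : ∀ e : G.edgeSet, G.IsLink (e : β) (s e) (t e)) (K : Finset G.vertexSet) :
    (edgeBoundary s t K).card ≠ 1 := by
  intro h1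
  obtain ⟨e, he⟩ := Finset.card_eq_one.1 h1
  have hmem : ∀ f, f ∈ edgeBoundary s t K ↔ ¬(s f ∈ K ↔ t f ∈ K) := fun f =>
    Finset.mem_filter_univ f
  obtain ⟨x, y, hx, hy⟩ : ∃ x y, x ∈ K ∧ y ∉ K := by
    have h2 : ¬(s e ∈ K ↔ t e ∈ K) := (hmem e).1 (by rw [he]; exact Finset.mem_singleton_self e)
    by_cases h3 : s e ∈ K
    · exact ⟨s e, t e, h3, fun h4 => h2 (iff_of_true h3 h4)⟩
    · exact ⟨t e, s e, by_contra fun h4 => h2 (iff_of_false h3 h4), h3⟩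
  -- Without its only boundary edge, `K` could not be left by any walk.
  have hwalk := (h.connected_deleteEdge e e.2).2 x x.2 y y.2
  have hinv : ∀ z : α, Relation.ReflTransGen (G.deleteEdges {(e : β)}).Adj x z →
      ∃ hz : z ∈ G.vertexSet, (⟨z, hz⟩ : G.vertexSet) ∈ K := by
    intro z hz
    induction hz with
    | refl => exact ⟨x.2, hx⟩
    | @tail a b _ hab ih =>
      obtain ⟨ha, haK⟩ := ih
      obtain ⟨f, hf⟩ := hab
      simp only [Graph.deleteEdges_isLink, Set.mem_singleton_iff] at hf
      obtain ⟨hf, hfe⟩ := hf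
      refine ⟨hf.right_mem, ?_⟩
      by_contra hbK
      have hj := (G.isLink_iff_joins s t hst ⟨f, hf.edge_mem⟩ ⟨a, ha⟩ ⟨b, hf.right_mem⟩).1 hf
      have : (⟨f, hf.edge_mem⟩ : G.edgeSet) ∈ edgeBoundary s t K := by
        rw [hmem]
        rcases hj with ⟨h1, h2⟩ | ⟨h1, h2⟩ <;> rw [h1, h2]
        · exact fun hi => hbK (hi.1 haK)
        · exact fun hi => hbK (hi.2 haK)
      rw [he, Finset.mem_singleton] at this
      exact hfe (congrArg Subtype.val this)
  exact hy (hinv y hwalk).2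

theorem Graph.IsSubcubic.endDegree_le_three {α β : Type*} [DecidableEq α] {G : Graph α β}
    [Fintype G.edgeSet] (h : G.IsSubcubic) (s t : G.edgeSet → G.vertexSet)
    (hst : ∀ e : G.edgeSet, G.IsLink (e : β) (s e) (t e)) (hne : ∀ e, s e ≠ t e)
    (v : G.vertexSet) : endDegree s t v ≤ 3 := by
  classical
  have h1 := h v v.2
  unfold endDegree
  rw [← Finset.card_union_of_disjoint]
  · have h2 : Subtype.val '' ((({e | s e = v} : Finset G.edgeSet) ∪
        ({e | t e = v} : Finset G.edgeSet) : Finset G.edgeSet) : Set G.edgeSet) ⊆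
        G.incidenceSet v := by
      rintro _ ⟨e, he, rfl⟩
      simp only [Finset.coe_union, Finset.coe_filter_univ, Set.mem_union, Set.mem_ofPred_eq] at he
      rcases he with he | he
      · rw [← he]; exact (hst e).inc_left
      · rw [← he]; exact (hst e).inc_right
    have h3 := (Set.encard_le_encard h2).trans h1
    rw [Subtype.val_injective.encard_image, Set.encard_coe_eq_coe_finsetCard] at h3
    exact_mod_cast h3
  · refine Finset.disjoint_left.2 fun e he he' => hne e ?_
    rw [Finset.mem_filter_univ] at he he'
    rw [he, he']

theorem Graph.IsSubcubic.finite_edgeSet {α β : Type*} {G : Graph α β} (h : G.IsSubcubic)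
    (hfin : G.vertexSet.Finite) : G.edgeSet.Finite := by
  refine (hfin.biUnion (t := G.incidenceSet) fun v hv =>
    Set.finite_of_encard_le_coe (k := 3) (h v hv)).subset fun e he => ?_
  obtain ⟨x, y, hxy⟩ := G.exists_isLink_of_mem_edgeSet he
  exact Set.mem_biUnion hxy.left_mem hxy.inc_left

/-- A bichromatic word of length four without equal consecutive letters alternates. -/
theorem alternating_of_encard_range_eq_two {C : Type*} (f : Fin 4 → C) (h : (Set.range f).encard = 2)
    (h01 : f 0 ≠ f 1) (h12 : f 1 ≠ f 2) (h23 : f 2 ≠ f 3) : f 0 = f 2 ∧ f 1 = f 3 := by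
  obtain ⟨a, b, -, hab⟩ := Set.encard_eq_two.1 h
  have hm : ∀ i, f i = a ∨ f i = b := fun i => by
    have : f i ∈ Set.range f := ⟨i, rfl⟩
    rwa [hab] at this
  rcases hm 0 with h0 | h0 <;> rcases hm 1 with h1 | h1 <;> rcases hm 2 with h2 | h2 <;>
    rcases hm 3 with h3 | h3 <;> simp_all

theorem lemma2p3 {α : Type u} {β : Type v} (G : Graph α β) (hfin : G.vertexSet.Finite)
    (hloop : G.Loopless) (hsub : G.IsSubcubic) (h2con : G.IsTwoConnected) :
    Graph.IsStarEdgeChoosable.{u, v, w} G 7 := by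
  classical
  intro C L hL
  have := hfin.fintype
  have := (hsub.finite_edgeSet hfin).fintype
  have hends : ∀ e : G.edgeSet, ∃ x y : G.vertexSet, G.IsLink (e : β) x y := fun e => by
    obtain ⟨x, y, h⟩ := G.exists_isLink_of_mem_edgeSet e.2
    exact ⟨⟨x, h.left_mem⟩, ⟨y, h.right_mem⟩, h⟩
  choose s t hst using hends
  have hne : ∀ e, s e ≠ t e := by
    intro e h
    have h' := hst e
    rw [h] at h'
    exact hloop.not_isLoopAt _ _ h'
  -- Lists of exactly seven colors are needed for the rigidity of residual lists of size three.
  choose L' hL'L hL'7 using fun e => Finset.exists_subset_card_eq (hL e)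
  obtain ⟨σ, hσL, hproper, hstar⟩ := exists_star_coloring s t hne
    (hsub.endDegree_le_three s t hst hne) (h2con.card_edgeBoundary_ne_one s t hst) L' hL'7
  have hinc : ∀ e : G.edgeSet, ∀ x, G.Inc (e : β) x → ∃ hx : x ∈ G.vertexSet,
      s e = ⟨x, hx⟩ ∨ t e = ⟨x, hx⟩ := fun e x ⟨y, hxy⟩ =>
    ⟨hxy.left_mem, ((G.isLink_iff_joins s t hst e ⟨x, hxy.left_mem⟩ ⟨y, hxy.right_mem⟩).1 hxy).left⟩
  have hprop : G.IsProperEdgeColoring σ := by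
    intro e f hef x hex hfx
    obtain ⟨hx, he⟩ := hinc e x hex
    obtain ⟨_, hf⟩ := hinc f x hfx
    exact hproper e f hef _ he hf
  have hwalk : ∀ (e : Fin 4 → G.edgeSet) (x₀ x₁ x₂ x₃ x₄ : α), G.IsLink (e 0 : β) x₀ x₁ →
      G.IsLink (e 1 : β) x₁ x₂ → G.IsLink (e 2 : β) x₂ x₃ → G.IsLink (e 3 : β) x₃ x₄ →
      x₀ ≠ x₁ → x₀ ≠ x₂ → x₀ ≠ x₃ → x₁ ≠ x₂ → x₁ ≠ x₃ → x₁ ≠ x₄ → x₂ ≠ x₃ → x₂ ≠ x₄ →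
      x₃ ≠ x₄ → (Set.range (σ ∘ e)).encard ≠ 2 := by
    intro e x₀ x₁ x₂ x₃ x₄ l0 l1 l2 l3 h01 h02 h03 h12 h13 h14 h23 h24 h34 h
    have n : ∀ i j : Fin 4, ∀ x y z, G.IsLink (e i : β) x y → G.IsLink (e j : β) y z → x ≠ z →
        σ (e i) ≠ σ (e j) := by
      intro i j x y z hi hj hxz
      refine hprop _ _ (fun h => hxz ?_) y hi.inc_right hj.inc_left
      rw [← h] at hj
      exact hi.symm.right_unique hj
    refine hstar e ⟨x₀, l0.left_mem⟩ ⟨x₁, l1.left_mem⟩ ⟨x₂, l2.left_mem⟩ ⟨x₃, l3.left_mem⟩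
      ⟨x₄, l3.right_mem⟩ ((G.isLink_iff_joins s t hst _ _ _).1 l0)
      ((G.isLink_iff_joins s t hst _ _ _).1 l1) ((G.isLink_iff_joins s t hst _ _ _).1 l2)
      ((G.isLink_iff_joins s t hst _ _ _).1 l3) ?_ ?_ ?_ ?_ ?_ ?_ ?_ ?_ ?_
      (alternating_of_encard_range_eq_two (σ ∘ e) h (n _ _ _ _ _ l0 l1 h02) (n _ _ _ _ _ l1 l2 h13)
        (n _ _ _ _ _ l2 l3 h24)) <;> simpa only [ne_eq, Subtype.mk.injEq]
  refine ⟨σ, ⟨hprop, ?_, ?_⟩, fun e => hL'L e (hσL e)⟩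
  · rintro e ⟨x, hx, hl⟩
    refine hwalk e (x 0) (x 1) (x 2) (x 3) (x 4) (hl 0) (hl 1) (hl 2) (hl 3) ?_ ?_ ?_ ?_ ?_ ?_ ?_ ?_
      ?_ <;> exact hx.ne (by decide)
  · rintro e ⟨x, hx, hl⟩
    refine hwalk e (x 0) (x 1) (x 2) (x 3) (x 0) (hl 0) (hl 1) (hl 2) (hl 3) ?_ ?_ ?_ ?_ ?_ ?_ ?_ ?_
      ?_ <;> exact hx.ne (by decide)
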